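/- **Definitions.** Let $f:\mathbb R^k\to[-\infty,+\infty]$ be finite at $\bar y$. A vector $v$ is a *regular subgradient* of $f$ at $\bar y$ if $f(y)\ge f(\bar y)+\langle v,y-\bar y\rangle+o(|y-\bar y|)$ as $y\to\bar y$. The *subdifferential* $\partial f(\bar y)$ is the set of limits of regular subgradients $v_k$ of $f$ at points $y_k\to\bar y$ with $f(y_k)\to f(\bar y)$. The *horizon subdifferential* $\partial^\infty f(\bar y)$ consists of $0$ and all limits of $t_kv_k$ with $t_k\downarrow 0$ and $v_k$ regular subgradients of $f$ at points $y_k\to\bar y$ with $f(y_k)\to f(\bar y)$. Where $f$ is infinite, these sets are empty. The function $f$ is *prox-regular* at $\bar y$ if it is finite at $\bar y$, lower semicontinuous around $\bar y$, and for every $\bar v\in\partial f(\bar y)$ there is $\rho>0$ with $f(y')\ge f(y)+\langle v,y'-y\rangle-\frac\rho2|y'-y|^2$ whenever $y,y'$ are near $\bar y$, $f(y)$ is near $f(\bar y)$, and $v\in\partial f(y)$ is near $\bar v$. A *local minimizer* of $f$ is understood to have a finite value. **Hypotheses.** Let $h:\mathbb R^m\to[-\infty,+\infty]$ and $c:\mathbb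 R^n\to\mathbb R^m$. Suppose that $c$ is $\mathcal C^2$ around $\bar x\in\mathbb R^n$, that $h$ is prox-regular at $\bar c=c(\bar x)$, that $h\circ c$ is critical at $\bar x$, i.e. $0\in\partial(h\circ c)(\bar x)$, and that $\partial^\infty h(\bar c)\cap\mathrm{Null}(\nabla c(\bar x)^*)=\{0\}$. For $x,d\in\mathbb R^n$ and $\mu>0$ put $$h_{x,\mu}(d)=h\big(c(x)+\nabla c(x)d\big)+\tfrac{\mu}{2}|d|^2 .$$ **Conclusion.** There is a number $\bar\mu\ge 0$ with the following two properties. (1) ($\bar\mu$ is a threshold for the proximal step.) There are $\delta>0$, $\rho\ge0$ and a map $d:\{x:|x-\bar x|\le\delta\}\times(\bar\mu,\infty)\to\mathbb R^n$ such that $d(x,\mu)$ is always a local minimizer of $h_{x,\mu}$ with $|d(x,\mu)|\le\rho|x-\bar x|$; and for all sequences $x_r\to\bar x$ and $\mu_r>\bar\mu$ with $\mu_r|x_r-\bar x|^2\to0$ or $h(c(x_r))\to h(\bar c)$, one has $h\big(c(x_r)+\nabla c(x_r)d(x_r,\mu_r)\big)\to h(\bar c)$. (2) Let $\mu_r>\bar\mu$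 and $x_r\to\bar x$ be sequences with $\mu_r|x_r-\bar x|\to0$. Then for all sufficiently large $r$ there is a local minimizer $d_r$ of $h_{x_r,\mu_r}$ such that $$d_r=O(|x_r-\bar x|)\quad\text{and}\quad h\big(c(x_r)+\nabla c(x_r)d_r\big)\to h(\bar c).$$ Moreover, if $0\notin\partial(h\circ c)(x_r)$ for all $r$, then for every such sequence of local minimizers $d_r$ one has $d_r\ne0$ and $h_{x_r,\mu_r}(d_r)<h_{x_r,\mu_r}(0)$ for all sufficiently large $r$. -/

import Mathlib

open Filter Topology Asymptotics

noncomputable section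

section Subdifferentials

variable {E : Type*} [NormedAddCommGroup E] [InnerProductSpace ℝ E]

/-- The extended-real-valued function `f` is finite at `x`. -/
def FiniteAt {X : Type*} (f : X → EReal) (x : X) : Prop :=
  f x ≠ ⊤ ∧ f x ≠ ⊥

/-- The regular (Fréchet) subdifferential of `f` at `x`: the vectors `v` with
`f y ≥ f x + ⟪v, y - x⟫ + o(‖y - x‖)`; empty if `f x` is infinite. -/
def regularSubdiff (f : E → EReal) (x : E) : Set E :=
  {v | FiniteAt f x ∧ ∀ ε : ℝ, 0 < ε → ∀ᶠ y in 𝓝 x,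
    f x + ((inner ℝ v (y - x) - ε * ‖y - x‖ : ℝ) : EReal) ≤ f y}

/-- The (limiting, Mordukhovich) subdifferential `∂f(x)`: limits of regular subgradients at
points tending to `x` whose values tend to `f x`; empty if `f x` is infinite. -/
def subdiff (f : E → EReal) (x : E) : Set E :=
  {v | FiniteAt f x ∧ ∃ (y : ℕ → E) (w : ℕ → E),
    Tendsto y atTop (𝓝 x) ∧ Tendsto (fun k => f (y k)) atTop (𝓝 (f x)) ∧
    (∀ k, w k ∈ regularSubdiff f (y k)) ∧ Tendsto w atTop (𝓝 v)}

/-- The horizon subdifferential `∂^∞f(x)`: `0`, together with all limits of `t k • w k` where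
`t k ↓ 0` and `w k` are regular subgradients at points tending to `x` whose values tend to
`f x`. -/
def horizonSubdiff (f : E → EReal) (x : E) : Set E :=
  {v | FiniteAt f x ∧ (v = 0 ∨ ∃ (y : ℕ → E) (w : ℕ → E) (t : ℕ → ℝ),
    Tendsto y atTop (𝓝 x) ∧ Tendsto (fun k => f (y k)) atTop (𝓝 (f x)) ∧
    (∀ k, w k ∈ regularSubdiff f (y k)) ∧
    (∀ k, 0 < t k) ∧ Tendsto t atTop (𝓝 0) ∧
    Tendsto (fun k => t k • w k) atTop (𝓝 v))}

/-- The prox-regularity inequality of `f` at `x` for the vector `v`. -/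
def ProxRegularIneq (f : E → EReal) (x v : E) : Prop :=
  ∃ ρ : ℝ, 0 < ρ ∧ ∃ ε : ℝ, 0 < ε ∧ ∀ y z : E, ‖y - x‖ < ε → ‖z - x‖ < ε →
    f x - (ε : EReal) < f y → f y < f x + (ε : EReal) →
    ∀ w ∈ subdiff f y, ‖w - v‖ < ε →
      f y + ((inner ℝ w (z - y) - ρ / 2 * ‖z - y‖ ^ 2 : ℝ) : EReal) ≤ f z

/-- `f` is prox-regular at `x`: it is finite at `x`, lower semicontinuous around `x`, and
satisfies the prox-regularity inequality for every subgradient at `x`. -/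
def ProxRegularAt (f : E → EReal) (x : E) : Prop :=
  FiniteAt f x ∧ (∀ᶠ y in 𝓝 x, LowerSemicontinuousAt f y) ∧
    ∀ v ∈ subdiff f x, ProxRegularIneq f x v

/-- `x` is critical for `f`: `0 ∈ ∂f(x)`. -/
def IsCriticalPt (f : E → EReal) (x : E) : Prop :=
  (0 : E) ∈ subdiff f x

/-- `x` is a local minimizer of `f`, with finite value. -/
def IsLocalMinimizer (f : E → EReal) (x : E) : Prop :=
  FiniteAt f x ∧ IsLocalMin f x

end Subdifferentials

section ProximalSubproblem

variable {n m : ℕ}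

/-- The linearized value `h(c(x) + ∇c(x) d)`. -/
def linValue (h : EuclideanSpace ℝ (Fin m) → EReal)
    (c : EuclideanSpace ℝ (Fin n) → EuclideanSpace ℝ (Fin m))
    (x d : EuclideanSpace ℝ (Fin n)) : EReal :=
  h (c x + fderiv ℝ c x d)

/-- The proximal linearized objective
`h_{x,μ}(d) = h(c(x) + ∇c(x) d) + (μ/2) |d|²`. -/
def proxLin (h : EuclideanSpace ℝ (Fin m) → EReal)
    (c : EuclideanSpace ℝ (Fin n) → EuclideanSpace ℝ (Fin m))
    (x : EuclideanSpace ℝ (Fin n)) (μ : ℝ) (d : EuclideanSpace ℝ (Fin n)) : EReal :=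
  linValue h c x d + ((μ / 2 * ‖d‖ ^ 2 : ℝ) : EReal)

/-- The transversality condition `∂^∞h(c(x)) ∩ Null(∇c(x)^*) = {0}`. -/
def Transversal (h : EuclideanSpace ℝ (Fin m) → EReal)
    (c : EuclideanSpace ℝ (Fin n) → EuclideanSpace ℝ (Fin m))
    (x : EuclideanSpace ℝ (Fin n)) : Prop :=
  horizonSubdiff h (c x) ∩ {v | ContinuousLinearMap.adjoint (fderiv ℝ c x) v = 0} = {0}

/-- `μbar` is a threshold for the proximal step at `xbar`: there are `δ > 0`, `ρ ≥ 0` and a map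
`d(x, μ)` giving, for `|x - xbar| ≤ δ` and `μ > μbar`, a local minimizer of `h_{x,μ}` of norm at
most `ρ |x - xbar|`; and along sequences `x r → xbar`, `μ r > μbar` with
`μ r |x r - xbar|² → 0` or `h(c(x r)) → h(c(xbar))`, the linearized values at `d(x r, μ r)`
tend to `h(c(xbar))`. -/
def IsProxStepThreshold (h : EuclideanSpace ℝ (Fin m) → EReal)
    (c : EuclideanSpace ℝ (Fin n) → EuclideanSpace ℝ (Fin m))
    (xbar : EuclideanSpace ℝ (Fin n)) (μbar : ℝ) : Prop :=
  ∃ δ : ℝ, 0 < δ ∧ ∃ ρ : ℝ, 0 ≤ ρ ∧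
    ∃ d : EuclideanSpace ℝ (Fin n) → ℝ → EuclideanSpace ℝ (Fin n),
      (∀ x ∈ Metric.closedBall xbar δ, ∀ μ : ℝ, μbar < μ →
        IsLocalMinimizer (proxLin h c x μ) (d x μ) ∧ ‖d x μ‖ ≤ ρ * ‖x - xbar‖) ∧
      (∀ (x : ℕ → EuclideanSpace ℝ (Fin n)) (μ : ℕ → ℝ),
        Tendsto x atTop (𝓝 xbar) → (∀ r, μbar < μ r) →
        (Tendsto (fun r => μ r * ‖x r - xbar‖ ^ 2) atTop (𝓝 0) ∨
          Tendsto (fun r => h (c (x r))) atTop (𝓝 (h (c xbar)))) →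
        Tendsto (fun r => linValue h c (x r) (d (x r) (μ r))) atTop (𝓝 (h (c xbar))))

/-- `d r` is, for all large `r`, a local minimizer of `h_{x r, μ r}`, with
`d r = O(|x r - xbar|)` and linearized values tending to `h(c(xbar))`. -/
def IsProxStepSeq (h : EuclideanSpace ℝ (Fin m) → EReal)
    (c : EuclideanSpace ℝ (Fin n) → EuclideanSpace ℝ (Fin m))
    (xbar : EuclideanSpace ℝ (Fin n)) (x : ℕ → EuclideanSpace ℝ (Fin n)) (μ : ℕ → ℝ)
    (d : ℕ → EuclideanSpace ℝ (Fin n)) : Prop :=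
  (∀ᶠ r in atTop, IsLocalMinimizer (proxLin h c (x r) (μ r)) (d r)) ∧
    (d =O[atTop] fun r => x r - xbar) ∧
    Tendsto (fun r => linValue h c (x r) (d r)) atTop (𝓝 (h (c xbar)))

end ProximalSubproblem

end

/-! The fuzzy chain rule turns the critical point of `h ∘ c` into multipliers of `h` that are
annihilated only approximately by the adjoint derivatives. Transversality keeps these multipliers
bounded (an unbounded sequence, normalized, would give a nonzero horizon subgradient in the null
space), so a limit `v ∈ ∂h(c x̄)` with `∇c(x̄)^* v = 0` exists.

Prox-regularity at `v` minorizes `h` near `c x̄` by a quadratic with slope `v`. Since `v` kills the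
range of `∇c(x̄)`, the linearized values satisfy `h(c(x) + ∇c(x)d) ≥ h(c x̄) - K(|x - x̄| + |d|)²`
(`exists_linearized_lower_bound`). Conversely, `d = x̄ - x` makes the linearization miss `c x̄` by
only `O(|x - x̄|²)`. Exact penalization, again with bounded multipliers, corrects this miss at
proportional cost and gives a step with value at most `h(c x̄) + O(|x - x̄|²)`
(`exists_trial_step`).

Once `μ` dominates `K`, the two bounds force the minimizer of `h_{x,μ}` over a fixed ball to have
norm `O(|x - x̄|)`, hence to be interior, and they squeeze its linearized value
(`isProxStepThreshold_of_bounds`).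

For descent, `-μd` is a regular subgradient of the linearized composite. It is small when `μ|x - x̄|
→ 0`, so it has a bounded multiplier with a uniform prox-regularity inequality; evaluating that at
`c(x)` gains `μ|d|²` and loses at most `(σ/2)L²|d|²`, where `L` bounds `|∇c(x)|` and `σ` is the
uniform constant (`exists_uniform_multipliers`, `eventually_descent_of_isProxStepSeq`). -/

/-- The filter of points tending to `x` along which the values of `f` tend to `f x`. -/
noncomputable def attentive {X : Type*} [TopologicalSpace X] (f : X → EReal) (x : X) : Filter X :=
  comap (fun y => (y, f y)) (𝓝 (x, f x))

theorem tendsto_attentive_iff {X ι : Type*} [TopologicalSpace X] {f : X → EReal} {x : X}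
    {l : Filter ι} {y : ι → X} :
    Tendsto y l (attentive f x) ↔ Tendsto y l (𝓝 x) ∧ Tendsto (fun i => f (y i)) l (𝓝 (f x)) := by
  rw [attentive, tendsto_comap_iff, nhds_prod_eq, tendsto_prod_iff']
  rfl

theorem attentive_le_nhds {X : Type*} [TopologicalSpace X] (f : X → EReal) (x : X) :
    attentive f x ≤ 𝓝 x :=
  (tendsto_attentive_iff.1 (tendsto_id (α := X) (x := attentive f x))).1

/-- The filter is pulled back from neighbourhoods of a point of the graph, so "eventually" can be
nested as it can for neighbourhoods. -/
theorem attentive_eventually_attentive {X : Type*} [TopologicalSpace X] {f : X → EReal} {x : X}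
    {P : X → Prop} (hP : ∀ᶠ y in attentive f x, P y) :
    ∀ᶠ y in attentive f x, ∀ᶠ z in attentive f y, P z := by
  rw [attentive, eventually_comap] at hP ⊢
  filter_upwards [hP.eventually_nhds] with p hp y hy
  subst hy
  rw [attentive, eventually_comap]
  exact hp

theorem attentive_prod_eventually {X Y : Type*} [TopologicalSpace X] [TopologicalSpace Y]
    {f : Y → EReal} {x : X} {y : Y} {P : X × Y → Prop}
    (hP : ∀ᶠ p in 𝓝 x ×ˢ attentive f y, P p) :
    ∀ᶠ p in 𝓝 x ×ˢ attentive f y, ∀ᶠ q in 𝓝 p.1 ×ˢ attentive f p.2, P q := by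
  obtain ⟨pa, ha, pb, hb, hab⟩ := eventually_prod_iff.1 hP
  refine eventually_prod_iff.2 ⟨_, ha.eventually_nhds, _, attentive_eventually_attentive hb, ?_⟩
  intro x hx y hy
  exact eventually_prod_iff.2 ⟨pa, hx, pb, hy, hab⟩

theorem EReal.nhds_coe_basis (a : ℝ) :
    (𝓝 (a : EReal)).HasBasis (fun r : ℝ => 0 < r)
      (fun r => Set.Ioo ((a - r : ℝ) : EReal) ((a + r : ℝ) : EReal)) := by
  refine ⟨fun t => ⟨fun ht => ?_, ?_⟩⟩
  · rw [EReal.nhds_coe, mem_map, Metric.mem_nhds_iff] at ht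
    obtain ⟨r, hr, hrt⟩ := ht
    refine ⟨r, hr, ?_⟩
    rintro y ⟨h1, h2⟩
    lift y to ℝ using ⟨h2.ne_top, h1.ne_bot⟩
    refine hrt ?_
    rw [Real.ball_eq_Ioo]
    exact ⟨EReal.coe_lt_coe_iff.1 h1, EReal.coe_lt_coe_iff.1 h2⟩
  · rintro ⟨r, hr, hrt⟩
    refine mem_of_superset (Ioo_mem_nhds ?_ ?_) hrt <;>
    · rw [EReal.coe_lt_coe_iff]; linarith

theorem eventually_attentive_iff {X : Type*} [PseudoMetricSpace X] {f : X → EReal} {x : X}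
    {a : ℝ} (ha : f x = a) {P : X → Prop} :
    (∀ᶠ y in attentive f x, P y) ↔ ∃ r : ℝ, 0 < r ∧ ∀ y, dist y x < r →
      ((a - r : ℝ) : EReal) < f y → f y < ((a + r : ℝ) : EReal) → P y := by
  rw [attentive, ha, nhds_prod_eq]
  have hb := (Metric.nhds_basis_ball (x := x)).prod (EReal.nhds_coe_basis a)
  rw [(hb.comap _).eventually_iff]
  constructor
  · rintro ⟨⟨r, s⟩, ⟨hr, hs⟩, H⟩
    refine ⟨min r s, lt_min hr hs, fun y h1 h2 h3 => H ⟨?_, ?_, ?_⟩⟩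
    · exact h1.trans_le (min_le_left _ _)
    · refine lt_of_le_of_lt (EReal.coe_le_coe_iff.2 ?_) h2
      linarith [min_le_right r s]
    · refine lt_of_lt_of_le h3 (EReal.coe_le_coe_iff.2 ?_)
      linarith [min_le_right r s]
  · rintro ⟨r, hr, H⟩
    exact ⟨(r, r), ⟨hr, hr⟩, fun y hy => H y hy.1 hy.2.1 hy.2.2⟩

/-! ### Subgradients: uniform prox-regularity and boundedness under transversality. -/

section Subgradients

variable {E F : Type*} [NormedAddCommGroup E] [InnerProductSpace ℝ E]
  [NormedAddCommGroup F] [InnerProductSpace ℝ F]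

theorem FiniteAt.exists_coe {X : Type*} {f : X → EReal} {x : X} (hx : FiniteAt f x) :
    ∃ a : ℝ, f x = a :=
  ⟨(f x).toReal, (EReal.coe_toReal hx.1 hx.2).symm⟩

theorem finiteAt_of_eq_coe {X : Type*} {f : X → EReal} {x : X} {a : ℝ} (hx : f x = a) :
    FiniteAt f x :=
  ⟨hx ▸ EReal.coe_ne_top a, hx ▸ EReal.coe_ne_bot a⟩

theorem mem_subdiff_iff_frequently {f : E → EReal} {x v : E} :
    v ∈ subdiff f x ↔ FiniteAt f x ∧
      ∃ᶠ p : E × E in attentive f x ×ˢ 𝓝 v, p.2 ∈ regularSubdiff f p.1 := by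
  refine and_congr_right fun _ => ⟨?_, fun hf => ?_⟩
  · rintro ⟨y, w, hy, hfy, hw, hwv⟩
    have ht : Tendsto (fun k => (y k, w k)) atTop (attentive f x ×ˢ 𝓝 v) :=
      (tendsto_attentive_iff.2 ⟨hy, hfy⟩).prodMk hwv
    exact ht.frequently (Frequently.of_forall hw)
  · have : (attentive f x).IsCountablyGenerated := by unfold attentive; infer_instance
    obtain ⟨p, hp, hp'⟩ := exists_seq_forall_of_frequently hf
    rw [tendsto_prod_iff'] at hp
    have h1 := tendsto_attentive_iff.1 hp.1
    exact ⟨_, _, h1.1, h1.2, hp', hp.2⟩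

theorem regularSubdiff_subset_subdiff (f : E → EReal) (x : E) :
    regularSubdiff f x ⊆ subdiff f x := fun v hv =>
  ⟨hv.1, fun _ => x, fun _ => v, tendsto_const_nhds, tendsto_const_nhds, fun _ => hv,
    tendsto_const_nhds⟩

theorem mem_regularSubdiff_of_quadratic {f : E → EReal} {x v : E} {a : ℝ} (ha : f x = a) (k : ℝ)
    (hk : ∀ᶠ y in 𝓝 x, ((a + inner ℝ v (y - x) - k * ‖y - x‖ ^ 2 : ℝ) : EReal) ≤ f y) :
    v ∈ regularSubdiff f x := by
  refine ⟨finiteAt_of_eq_coe ha, fun ε hε => ?_⟩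
  have ht : Tendsto (fun y => k * ‖y - x‖) (𝓝 x) (𝓝 0) := by
    have : Continuous fun y => k * ‖y - x‖ := by fun_prop
    simpa using this.tendsto x
  filter_upwards [hk, ht.eventually (gt_mem_nhds hε)] with y hy hy'
  refine le_trans ?_ hy
  rw [ha, ← EReal.coe_add, EReal.coe_le_coe_iff]
  nlinarith [norm_nonneg (y - x)]

/-- The constants in the prox-regularity inequality can be chosen uniformly over bounded sets of
subgradients. -/
theorem ProxRegularAt.eventually_of_norm_le [ProperSpace E] {f : E → EReal} {x : E}
    (hf : ProxRegularAt f x) (B : ℝ) :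
    ∃ ρ : ℝ, 0 < ρ ∧ ∀ᶠ p : E × E in attentive f x ×ˢ 𝓝 x, ∀ w ∈ subdiff f p.1, ‖w‖ ≤ B →
      f p.1 + ((inner ℝ w (p.2 - p.1) - ρ / 2 * ‖p.2 - p.1‖ ^ 2 : ℝ) : EReal) ≤ f p.2 := by
  obtain ⟨a, ha⟩ := hf.1.exists_coe
  suffices H : ∃ ρ : ℝ, 0 < ρ ∧ ∀ᶠ p : E × E in attentive f x ×ˢ 𝓝 x, ∀ w ∈ subdiff f p.1,
      w ∈ Metric.closedBall (0 : E) B →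
      f p.1 + ((inner ℝ w (p.2 - p.1) - ρ / 2 * ‖p.2 - p.1‖ ^ 2 : ℝ) : EReal) ≤ f p.2 by
    simpa using H
  -- Compactness reduces the claim to a neighbourhood of each single `v`, because finitely many
  -- constants can be replaced by their maximum.
  refine (isCompact_closedBall (0 : E) B).induction_on
    (p := fun S => ∃ ρ : ℝ, 0 < ρ ∧ ∀ᶠ p : E × E in attentive f x ×ˢ 𝓝 x,
      ∀ w ∈ subdiff f p.1, w ∈ S →
      f p.1 + ((inner ℝ w (p.2 - p.1) - ρ / 2 * ‖p.2 - p.1‖ ^ 2 : ℝ) : EReal) ≤ f p.2)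
    ⟨1, one_pos, by simp⟩ ?_ ?_ ?_
  · rintro S T hST ⟨ρ, hρ, H⟩
    exact ⟨ρ, hρ, H.mono fun p hp w hw hwS => hp w hw (hST hwS)⟩
  · rintro S T ⟨ρ, hρ, HS⟩ ⟨σ, hσ, HT⟩
    refine ⟨max ρ σ, lt_max_of_lt_left hρ, ?_⟩
    filter_upwards [HS, HT] with p hS hT w hw hwST
    have key : ∀ τ ≤ max ρ σ,
        f p.1 + ((inner ℝ w (p.2 - p.1) - max ρ σ / 2 * ‖p.2 - p.1‖ ^ 2 : ℝ) : EReal) ≤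
        f p.1 + ((inner ℝ w (p.2 - p.1) - τ / 2 * ‖p.2 - p.1‖ ^ 2 : ℝ) : EReal) := by
      intro τ hτ
      gcongr
    rcases hwST with hwS | hwT
    · exact (key ρ (le_max_left _ _)).trans (hS w hw hwS)
    · exact (key σ (le_max_right _ _)).trans (hT w hw hwT)
  · intro v _
    by_cases hv : v ∈ subdiff f x
    · obtain ⟨ρ, hρ, ε, hε, H⟩ := hf.2.2 v hv
      refine ⟨Metric.ball v ε, mem_nhdsWithin_of_mem_nhds (Metric.ball_mem_nhds v hε), ρ, hρ, ?_⟩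
      refine eventually_prod_iff.2 ⟨_, (eventually_attentive_iff ha).2 ⟨ε, hε,
        fun y h1 h2 h3 => And.intro h1 (And.intro h2 h3)⟩, _, Metric.ball_mem_nhds x hε, ?_⟩
      intro y hy z hz w hw hwv
      refine H y z (by simpa [dist_eq_norm] using hy.1) (by simpa [dist_eq_norm] using hz)
        ?_ ?_ w hw (by simpa [dist_eq_norm] using hwv)
      · rw [ha, ← EReal.coe_sub]; exact hy.2.1
      · rw [ha, ← EReal.coe_add]; exact hy.2.2
    -- If `v` is not a subgradient at `x`, then no subgradient at an attentively close point is near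
    -- `v`, and the inequality is vacuous.
    · rw [mem_subdiff_iff_frequently, not_and, not_frequently] at hv
      obtain ⟨pa, hpa, pb, hpb, hab⟩ := eventually_prod_iff.1 (hv hf.1)
      refine ⟨{w | ∀ᶠ z in 𝓝 w, pb z}, mem_nhdsWithin_of_mem_nhds hpb.eventually_nhds, 1, one_pos,
        eventually_prod_iff.2 ⟨_, attentive_eventually_attentive hpa, _, univ_mem, ?_⟩⟩
      intro y hy z _ w hw hwS
      exact absurd (eventually_prod_iff.2 ⟨pa, hy, pb, hwS, hab⟩)
        (mem_subdiff_iff_frequently.1 hw).2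

theorem adjoint_apply_eq_of_tendsto [CompleteSpace E] [CompleteSpace F] {ι : Type*}
    {l : Filter ι} [l.NeBot] {T : ι → E →L[ℝ] F} {S : E →L[ℝ] F} {v : ι → F} {w : F} {z : E}
    (hT : Tendsto T l (𝓝 S)) (hv : Tendsto v l (𝓝 w))
    (hz : Tendsto (fun i => ContinuousLinearMap.adjoint (T i) (v i)) l (𝓝 z)) :
    ContinuousLinearMap.adjoint S w = z := by
  refine ext_inner_right ℝ fun e => ?_
  rw [ContinuousLinearMap.adjoint_inner_left]
  have h1 : Tendsto (fun i => T i e) l (𝓝 (S e)) :=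
    ((ContinuousLinearMap.apply ℝ F e).continuous.tendsto S).comp hT
  refine tendsto_nhds_unique (hv.inner h1) ?_
  refine (hz.inner (tendsto_const_nhds (x := e))).congr fun i => ?_
  rw [ContinuousLinearMap.adjoint_inner_left]

/-- Under the transversality condition, regular subgradients near `(y, h y)` whose images under
the adjoints `(A x')^*` are bounded are themselves bounded. -/
theorem exists_norm_le_of_transversal {X : Type*} [TopologicalSpace X] [FirstCountableTopology X]
    [CompleteSpace E] [ProperSpace F] {h : F → EReal}
    {y : F} (hy : FiniteAt h y) {A : X → E →L[ℝ] F} {x : X} (hA : ContinuousAt A x)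
    (ht : ∀ v ∈ horizonSubdiff h y, ContinuousLinearMap.adjoint (A x) v = 0 → v = 0) (C : ℝ) :
    ∃ B : ℝ, ∀ᶠ p : X × F in 𝓝 x ×ˢ attentive h y, ∀ v ∈ regularSubdiff h p.2,
      ‖ContinuousLinearMap.adjoint (A p.1) v‖ ≤ C → ‖v‖ ≤ B := by
  -- Otherwise there are violations with `‖v k‖ > k + 1`. Normalized, they subconverge to a unit
  -- horizon subgradient, and the bound `C` on the images puts it in the kernel of the adjoint.
  by_contra! hcon
  have : (attentive h y).IsCountablyGenerated := by unfold attentive; infer_instance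
  obtain ⟨U, hU⟩ := (𝓝 x ×ˢ attentive h y).exists_antitone_basis
  have hex : ∀ k : ℕ, ∃ (p : X × F) (v : F), p ∈ U k ∧ v ∈ regularSubdiff h p.2 ∧
      ‖ContinuousLinearMap.adjoint (A p.1) v‖ ≤ C ∧ (k + 1 : ℝ) < ‖v‖ := by
    intro k
    obtain ⟨p, ⟨v, hv, hvC, hvB⟩, hp⟩ := ((hcon (k + 1)).and_eventually (hU.mem k)).exists
    exact ⟨p, v, hp, hv, hvC, hvB⟩
  choose p v hpU hv hvC hvB using hex
  have hp : Tendsto p atTop (𝓝 x ×ˢ attentive h y) := hU.tendsto hpU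
  rw [tendsto_prod_iff'] at hp
  have hpos : ∀ k, 0 < ‖v k‖ := fun k => lt_trans (by positivity) (hvB k)
  have hunit : ∀ k, ‖v k‖⁻¹ • v k ∈ Metric.sphere (0 : F) 1 := by
    intro k
    simp [norm_smul, (hpos k).ne']
  obtain ⟨w, hw, φ, hφ, hlim⟩ := (isCompact_sphere (0 : F) 1).tendsto_subseq hunit
  have hinv : Tendsto (fun k => ‖v k‖⁻¹) atTop (𝓝 0) := by
    refine tendsto_inv_atTop_zero.comp (tendsto_atTop_mono (fun k => ?_)
      tendsto_natCast_atTop_atTop)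
    linarith [hvB k]
  have hφ' := hφ.tendsto_atTop
  have hat := tendsto_attentive_iff.1 (hp.2.comp hφ')
  have hhor : w ∈ horizonSubdiff h y :=
    ⟨hy, Or.inr ⟨fun k => (p (φ k)).2, fun k => v (φ k), fun k => ‖v (φ k)‖⁻¹, hat.1, hat.2,
      fun k => hv _, fun k => inv_pos.2 (hpos _), hinv.comp hφ', hlim⟩⟩
  have hzero : Tendsto (fun k => ContinuousLinearMap.adjoint (A (p (φ k)).1)
      (‖v (φ k)‖⁻¹ • v (φ k))) atTop (𝓝 0) := by
    refine squeeze_zero_norm (a := fun k => ‖v (φ k)‖⁻¹ * C) (fun k => ?_) ?_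
    · rw [map_smul, norm_smul, norm_inv, norm_norm]
      exact mul_le_mul_of_nonneg_left (hvC _) (inv_nonneg.2 (norm_nonneg _))
    · simpa using (hinv.comp hφ').mul_const C
  have := ht w hhor (adjoint_apply_eq_of_tendsto (hA.tendsto.comp (hp.1.comp hφ')) hlim hzero)
  simp [this] at hw

end Subgradients

/-! ### Truncation to real values. -/

/-- The truncation of an extended real number to the interval `[a - 1, a + 1]`. -/
noncomputable def clampAround (a : ℝ) (t : EReal) : ℝ :=
  (max (min t ((a + 1 : ℝ) : EReal)) ((a - 1 : ℝ) : EReal)).toReal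

theorem coe_clampAround (a : ℝ) (t : EReal) :
    (clampAround a t : EReal) = max (min t ((a + 1 : ℝ) : EReal)) ((a - 1 : ℝ) : EReal) := by
  refine EReal.coe_toReal (ne_of_lt ?_) (ne_of_gt ?_)
  · exact max_lt (lt_of_le_of_lt (min_le_right _ _) (EReal.coe_lt_top _)) (EReal.coe_lt_top _)
  · exact lt_of_lt_of_le (EReal.bot_lt_coe _) (le_max_right _ _)

theorem clampAround_le {a : ℝ} {t : EReal} (ht : ((a - 1 : ℝ) : EReal) ≤ t) :
    (clampAround a t : EReal) ≤ t := by
  rw [coe_clampAround]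
  exact max_le (min_le_left _ _) ht

/-- This transfers information back from the truncation: a minimizer whose truncated value stays
below `a + 1` carries the true value of `f`. -/
theorem eq_clampAround_of_lt {a : ℝ} {t : EReal} (ht : ((a - 1 : ℝ) : EReal) ≤ t)
    (h : clampAround a t < a + 1) : t = clampAround a t := by
  rw [← EReal.coe_lt_coe_iff, coe_clampAround, max_lt_iff, min_lt_iff] at h
  have h1 : t < ((a + 1 : ℝ) : EReal) := h.1.resolve_right (lt_irrefl _)
  rw [coe_clampAround, min_eq_left h1.le, max_eq_left ht]

theorem le_clampAround {a s : ℝ} {t : EReal} (hs : s ≤ a + 1) (hst : (s : EReal) ≤ t) :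
    s ≤ clampAround a t := by
  rw [← EReal.coe_le_coe_iff, coe_clampAround]
  exact le_max_of_le_left (le_min hst (EReal.coe_le_coe_iff.2 hs))

theorem clampAround_self (a : ℝ) : clampAround a (a : EReal) = a := by
  refine le_antisymm ?_ (le_clampAround (by linarith) le_rfl)
  exact EReal.coe_le_coe_iff.1 (clampAround_le (EReal.coe_le_coe_iff.2 (by linarith)))

theorem lowerSemicontinuousAt_clampAround {X : Type*} [TopologicalSpace X] {f : X → EReal} {x : X}
    (hf : LowerSemicontinuousAt f x) (a : ℝ) :
    LowerSemicontinuousAt (fun y => clampAround a (f y)) x := by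
  intro s hs
  change s < clampAround a (f x) at hs
  change ∀ᶠ y in 𝓝 x, s < clampAround a (f y)
  rw [← EReal.coe_lt_coe_iff, coe_clampAround, lt_max_iff, lt_min_iff] at hs
  rcases hs with ⟨h1, h2⟩ | h
  · filter_upwards [hf _ h1] with y hy
    rw [← EReal.coe_lt_coe_iff, coe_clampAround]
    exact lt_max_of_lt_left (lt_min hy h2)
  · refine Eventually.of_forall fun y => ?_
    rw [← EReal.coe_lt_coe_iff, coe_clampAround]
    exact lt_max_of_lt_right h

/-! ### Fuzzy chain rule and exact multipliers. -/

section ChainRule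

variable {E F : Type*} [NormedAddCommGroup E] [InnerProductSpace ℝ E]
  [NormedAddCommGroup F] [InnerProductSpace ℝ F]

/-- Test along `e = -t • w` with `t ↓ 0`. -/
theorem norm_le_of_eventually_inner_ge {w : E} {η : ℝ} (hη : 0 ≤ η)
    (h : ∀ ε : ℝ, 0 < ε → ∀ᶠ e in 𝓝 (0 : E), -(η + ε) * ‖e‖ ≤ inner ℝ w e) : ‖w‖ ≤ η := by
  rcases eq_or_ne w 0 with rfl | hw
  · simpa using hη
  refine le_of_forall_pos_le_add fun ε hε => ?_
  have ht : Tendsto (fun t : ℝ => -(t • w)) (𝓝[>] 0) (𝓝 0) := by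
    have : Continuous fun t : ℝ => -(t • w) := by fun_prop
    exact (this.tendsto' 0 0 (by simp)).mono_left nhdsWithin_le_nhds
  obtain ⟨t, ht1, ht0⟩ := ((ht.eventually (h ε hε)).and self_mem_nhdsWithin).exists
  have ht0 : 0 < t := ht0
  rw [norm_neg, norm_smul, inner_neg_right, inner_smul_right, real_inner_self_eq_norm_sq,
    Real.norm_of_nonneg ht0.le] at ht1
  have hw' : 0 < ‖w‖ := norm_pos_iff.2 hw
  have h2 : 0 ≤ (t * ‖w‖) * (η + ε - ‖w‖) := by nlinarith
  nlinarith [nonneg_of_mul_nonneg_right h2 (by positivity)]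

/-- Fuzzy chain rule: a regular subgradient of `h ∘ G` is approximated by the images under the
adjoint of the derivative of `G` of regular subgradients of `h` at nearby points. -/
theorem frequently_chain_of_mem_regularSubdiff [ProperSpace E] [ProperSpace F] {h : F → EReal}
    {G : E → F} {x u : E} (hG : ∀ᶠ z in 𝓝 x, DifferentiableAt ℝ G z)
    (hl : ∀ᶠ y in 𝓝 (G x), LowerSemicontinuousAt h y)
    (hu : u ∈ regularSubdiff (fun z => h (G z)) x) {η : ℝ} (hη : 0 < η) :
    ∃ᶠ q : E × F in 𝓝 x ×ˢ attentive h (G x), ∃ v ∈ regularSubdiff h q.2,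
      ‖ContinuousLinearMap.adjoint (fderiv ℝ G q.1) v - u‖ ≤ η := by
  obtain ⟨a, ha⟩ := hu.1.exists_coe
  intro hcon
  obtain ⟨pa, hpa, pb, hpb, hab⟩ := eventually_prod_iff.1 hcon
  obtain ⟨r, hr, hrb⟩ := (eventually_attentive_iff ha).1 hpb
  set s : ℝ := min r 1 with hs
  have hs0 : 0 < s := lt_min hr one_pos
  have hlx : ∀ᶠ y in 𝓝 (G x), ((a - s : ℝ) : EReal) < h y :=
    hl.self_of_nhds _ (show ((a - s : ℝ) : EReal) < h (G x) by
      rw [ha, EReal.coe_lt_coe_iff]; linarith)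
  have hsmall : ∀ᶠ z in 𝓝 x, inner ℝ u (z - x) < s := by
    have : Continuous fun z => (inner ℝ u (z - x) : ℝ) := by fun_prop
    exact (this.tendsto' x 0 (by simp)).eventually (gt_mem_nhds hs0)
  obtain ⟨ε, hε, hεx⟩ := Metric.nhds_basis_closedBall.eventually_iff.1
    (hpa.and (hG.and (hsmall.and (hu.2 (η / 2) (half_pos hη)))))
  obtain ⟨δ, hδ, hδy⟩ := Metric.nhds_basis_closedBall.eventually_iff.1
    (hl.and (hlx.and (Metric.ball_mem_nhds (G x) hr)))
  set H : F → ℝ := fun y => clampAround a (h y) with hH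
  have hHx : H (G x) = a := by simp only [hH, ha, clampAround_self]
  have hlow : ∀ y ∈ Metric.closedBall (G x) δ, ((a - 1 : ℝ) : EReal) ≤ h y := fun y hy =>
    le_trans (EReal.coe_le_coe_iff.2 (by linarith [min_le_right r 1])) (hδy hy).2.1.le
  have hHlow : ∀ y ∈ Metric.closedBall (G x) δ, a - s ≤ H y := fun y hy =>
    le_clampAround (by linarith) (hδy hy).2.1.le
  have hHlsc : LowerSemicontinuousOn H (Metric.closedBall (G x) δ) := fun y hy =>
    (lowerSemicontinuousAt_clampAround (hδy hy).1 a).lowerSemicontinuousWithinAt _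
  set K : Set (E × F) := Metric.closedBall x ε ×ˢ Metric.closedBall (G x) δ with hK
  have hKc : IsCompact K := (isCompact_closedBall _ _).prod (isCompact_closedBall _ _)
  have hGc : ContinuousOn G (Metric.closedBall x ε) := fun z hz =>
    (hεx hz).2.1.continuousAt.continuousWithinAt
  -- The constraint `y = G z` is relaxed by a quadratic penalty. The cone `η‖z - x‖` makes `x` a
  -- strict minimizer of the constrained problem.
  set Ψ : ℕ → E × F → ℝ := fun k p =>
    H p.2 + (k * ‖p.2 - G p.1‖ ^ 2 - inner ℝ u (p.1 - x) + η * ‖p.1 - x‖) with hΨ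
  have hΨlsc : ∀ k, LowerSemicontinuousOn (Ψ k) K := by
    intro k
    refine LowerSemicontinuousOn.add (hHlsc.comp continuousOn_snd fun p hp => hp.2)
      (ContinuousOn.lowerSemicontinuousOn ?_)
    have hG1 : ContinuousOn (fun p : E × F => G p.1) K :=
      hGc.comp continuousOn_fst fun p hp => hp.1
    exact ((continuousOn_const.mul ((continuousOn_snd.sub hG1).norm.pow 2)).sub
      (continuousOn_const.inner (continuousOn_fst.sub continuousOn_const))).add
      (continuousOn_const.mul (continuousOn_fst.sub continuousOn_const).norm)
  have hx0K : (x, G x) ∈ K :=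
    ⟨Metric.mem_closedBall_self hε.le, Metric.mem_closedBall_self hδ.le⟩
  have hΨ0 : ∀ k, Ψ k (x, G x) = a := by intro k; simp [hΨ, hHx]
  -- The lower bound on `H` rules out `y ≠ G z` as `k` grows. On the graph, the subgradient
  -- inequality with slack `η / 2` contradicts the cone unless `z = x`.
  have hinter : ∀ p ∈ ⋂ k, K ∩ Ψ k ⁻¹' Set.Iic a, p = (x, G x) := by
    intro p hp
    rw [Set.mem_iInter] at hp
    have hpK := (hp 0).1
    have hle : ∀ k, Ψ k p ≤ a := fun k => (hp k).2
    have hy : p.2 = G p.1 := by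
      by_contra hne
      have hpos : 0 < ‖p.2 - G p.1‖ ^ 2 := by
        have := norm_pos_iff.2 (sub_ne_zero.2 hne); positivity
      obtain ⟨k, hk⟩ := exists_nat_gt
        ((s + inner ℝ u (p.1 - x) - η * ‖p.1 - x‖) / ‖p.2 - G p.1‖ ^ 2)
      rw [div_lt_iff₀ hpos] at hk
      have h1 := hle k
      have h2 := hHlow _ hpK.2
      simp only [hΨ] at h1
      linarith
    have hxx : p.1 = x := by
      have h1 := hle 0
      obtain ⟨-, -, h3, h4⟩ := hεx hpK.1
      beta_reduce at h4
      rw [ha, ← EReal.coe_add] at h4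
      have h5 : a + (inner ℝ u (p.1 - x) - η / 2 * ‖p.1 - x‖) ≤ H p.2 := by
        rw [hy]
        refine le_clampAround ?_ h4
        have : 0 ≤ η / 2 * ‖p.1 - x‖ := by positivity
        linarith [min_le_right r 1]
      simp only [hΨ, hy, sub_self, norm_zero] at h1
      rw [hy] at h5
      have : ‖p.1 - x‖ ≤ 0 := by
        by_contra! hpos
        nlinarith
      exact sub_eq_zero.1 (norm_le_zero_iff.1 this)
    exact Prod.ext hxx (by rw [hy, hxx])
  have hFc : ∀ k, IsCompact (K ∩ Ψ k ⁻¹' Set.Iic a) := fun k =>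
    (hΨlsc k).isCompact_inter_preimage_Iic hKc a
  -- The sublevel sets are compact and decreasing, so for some `k` the whole set lies in the open
  -- box. A minimizer of `Ψ k` is then interior.
  obtain ⟨k, hk⟩ := exists_subset_nhds_of_isCompact' (V := fun k => K ∩ Ψ k ⁻¹' Set.Iic a)
    (U := Metric.ball x ε ×ˢ Metric.ball (G x) δ)
    (Antitone.directed_ge fun i j hij p hp => ⟨hp.1, by
      refine le_trans ?_ (show Ψ j p ≤ a from hp.2)
      simp only [hΨ]
      gcongr⟩) hFc (fun k => (hFc k).isClosed)
    (fun p hp => by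
      rw [hinter p hp]
      exact prod_mem_nhds (Metric.ball_mem_nhds _ hε) (Metric.ball_mem_nhds _ hδ))
  obtain ⟨⟨z, y⟩, hp, hmin⟩ := (hΨlsc k).exists_isMinOn ⟨_, hx0K⟩ hKc
  have hpa' : Ψ k (z, y) ≤ a := hΨ0 k ▸ hmin hx0K
  obtain ⟨hzb, hyb⟩ := hk ⟨hp, hpa'⟩
  obtain ⟨hz1, hz2, hz3, -⟩ := hεx hp.1
  obtain ⟨hy1, hy2, hy3⟩ := hδy hp.2
  have hHy : H y < a + s := by
    simp only [hΨ] at hpa'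
    have : 0 ≤ k * ‖y - G z‖ ^ 2 := by positivity
    have : 0 ≤ η * ‖z - x‖ := by positivity
    simp only at hz3
    linarith
  have hy4 : h y = H y := eq_clampAround_of_lt (hlow y hp.2) (by linarith [min_le_right r 1])
  -- Optimality in `y` makes this a regular subgradient. Optimality in `z` below bounds the
  -- derivative of the smooth part, `(∇G z)^* v - u`, by the Lipschitz constant `η` of the cone.
  set v : F := -(2 * k : ℝ) • (y - G z) with hv
  have hvreg : v ∈ regularSubdiff h y := by
    refine mem_regularSubdiff_of_quadratic hy4 k ?_
    filter_upwards [Metric.isOpen_ball.mem_nhds hyb] with y' hy'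
    have hy'c := Metric.ball_subset_closedBall hy'
    refine le_trans ?_ (clampAround_le (hlow y' hy'c))
    rw [EReal.coe_le_coe_iff]
    have h1 : Ψ k (z, y) ≤ Ψ k (z, y') := hmin (⟨hp.1, hy'c⟩ : (z, y') ∈ K)
    simp only [hΨ] at h1
    have h2 : ‖y' - G z‖ ^ 2 = ‖y - G z‖ ^ 2 + 2 * inner ℝ (y - G z) (y' - y) + ‖y' - y‖ ^ 2 := by
      rw [← norm_add_sq_real]; congr 2; abel
    rw [hv, inner_smul_left]
    simp only [conj_trivial]
    change _ ≤ H y'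
    rw [h2] at h1
    linarith
  refine hab hz1 (hrb y hy3 ?_ ?_) ⟨v, hvreg, ?_⟩
  · refine lt_of_le_of_lt (EReal.coe_le_coe_iff.2 ?_) hy2
    linarith [min_le_left r 1]
  · rw [hy4, EReal.coe_lt_coe_iff]
    linarith [min_le_left r 1]
  refine norm_le_of_eventually_inner_ge hη.le fun ε' hε' => ?_
  have hder : HasFDerivAt (fun z' => k * ‖y - G z'‖ ^ 2 - inner ℝ u (z' - x))
      (innerSL ℝ (ContinuousLinearMap.adjoint (fderiv ℝ G z) v - u)) z := by
    have h1 := (((hasFDerivAt_const y z).sub hz2.hasFDerivAt).norm_sq).const_mul (k : ℝ)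
    have h2 : HasFDerivAt (fun z' => (inner ℝ u (z' - x) : ℝ)) (innerSL ℝ u) z :=
      (innerSL ℝ u).hasFDerivAt.comp z ((hasFDerivAt_id z).sub_const x)
    refine (h1.sub h2).congr_fderiv ?_
    ext e
    simp [hv, ContinuousLinearMap.adjoint_inner_left]
    ring
  have hlo := hder.isLittleO.def hε'
  have hmap : Tendsto (fun e : E => z + e) (𝓝 0) (𝓝 z) := by
    have : Continuous fun e : E => z + e := by fun_prop
    exact this.tendsto' 0 z (by simp)
  filter_upwards [hmap.eventually hlo, hmap.eventually (Metric.isOpen_ball.mem_nhds hzb)]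
    with e he heb
  have h1 : Ψ k (z, y) ≤ Ψ k (z + e, y) :=
    hmin (⟨Metric.ball_subset_closedBall heb, hp.2⟩ : (z + e, y) ∈ K)
  simp only [hΨ] at h1
  have h2 := le_of_abs_le he
  simp only [add_sub_cancel_left, innerSL_apply_apply] at h2
  have h3 : ‖z + e - x‖ ≤ ‖z - x‖ + ‖e‖ := by
    rw [add_sub_right_comm]; exact norm_add_le _ _
  nlinarith

/-- Exact multipliers from approximate ones, when the approximate ones are bounded. -/
theorem exists_mem_subdiff_adjoint_eq [CompleteSpace E] [ProperSpace F] {h : F → EReal}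
    {A : E → E →L[ℝ] F} {x u : E} {y : F} (hy : FiniteAt h y) (hA : ContinuousAt A x) {B : ℝ}
    (hu : ∀ η : ℝ, 0 < η → ∃ᶠ q : E × F in 𝓝 x ×ˢ attentive h y, ∃ v ∈ regularSubdiff h q.2,
      ‖ContinuousLinearMap.adjoint (A q.1) v - u‖ ≤ η)
    (hB : ∀ᶠ q : E × F in 𝓝 x ×ˢ attentive h y, ∀ v ∈ regularSubdiff h q.2,
      ‖ContinuousLinearMap.adjoint (A q.1) v‖ ≤ ‖u‖ + 1 → ‖v‖ ≤ B) :
    ∃ v ∈ subdiff h y, ‖v‖ ≤ B ∧ ContinuousLinearMap.adjoint (A x) v = u := by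
  have : (attentive h y).IsCountablyGenerated := by unfold attentive; infer_instance
  obtain ⟨U, hU⟩ := (𝓝 x ×ˢ attentive h y).exists_antitone_basis
  have hex : ∀ k : ℕ, ∃ (q : E × F) (v : F), q ∈ U k ∧ v ∈ regularSubdiff h q.2 ∧
      ‖ContinuousLinearMap.adjoint (A q.1) v - u‖ ≤ 1 / ((k : ℝ) + 1) ∧
      v ∈ Metric.closedBall (0 : F) B := by
    intro k
    obtain ⟨q, ⟨v, hv, hvu⟩, hqU, hqB⟩ :=
      ((hu (1 / ((k : ℝ) + 1)) (by positivity)).and_eventually (Eventually.and (hU.mem k) hB)).exists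
    refine ⟨q, v, hqU, hv, hvu, ?_⟩
    rw [mem_closedBall_zero_iff]
    refine hqB v hv ?_
    have h1 : 1 / ((k : ℝ) + 1) ≤ 1 := by
      rw [div_le_one (by positivity)]; linarith [(Nat.cast_nonneg k : (0 : ℝ) ≤ k)]
    calc ‖ContinuousLinearMap.adjoint (A q.1) v‖
        = ‖u + (ContinuousLinearMap.adjoint (A q.1) v - u)‖ := by rw [add_sub_cancel]
      _ ≤ ‖u‖ + ‖ContinuousLinearMap.adjoint (A q.1) v - u‖ := norm_add_le _ _
      _ ≤ ‖u‖ + 1 := by linarith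
  choose q v hqU hv hvu hvB using hex
  obtain ⟨w, hw, φ, hφ, hlim⟩ := (isCompact_closedBall (0 : F) B).tendsto_subseq hvB
  have hq := tendsto_prod_iff'.1 ((hU.tendsto hqU).comp hφ.tendsto_atTop)
  have hat := tendsto_attentive_iff.1 hq.2
  refine ⟨w, ⟨hy, _, _, hat.1, hat.2, fun k => hv (φ k), hlim⟩, by simpa using hw, ?_⟩
  refine adjoint_apply_eq_of_tendsto (hA.tendsto.comp hq.1) hlim ?_
  refine tendsto_iff_norm_sub_tendsto_zero.2 (squeeze_zero (fun k => norm_nonneg _)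
    (fun k => hvu (φ k)) (tendsto_one_div_add_atTop_nhds_zero_nat.comp hφ.tendsto_atTop))

end ChainRule

/-! ### Linearization estimates for the composite. -/

section ProxRegularComposite

variable {E F : Type*} [NormedAddCommGroup E] [InnerProductSpace ℝ E]
  [NormedAddCommGroup F] [InnerProductSpace ℝ F]

/-- A diagonal argument: half of `η` is spent on reaching a nearby regular subgradient, half on the
fuzzy rule there. -/
theorem frequently_chain_of_mem_subdiff [ProperSpace E] [ProperSpace F] {h : F → EReal}
    {G : E → F} {x u : E} (hG : ∀ᶠ z in 𝓝 x, DifferentiableAt ℝ G z)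
    (hl : ∀ᶠ y in 𝓝 (G x), LowerSemicontinuousAt h y)
    (hu : u ∈ subdiff (fun z => h (G z)) x) {η : ℝ} (hη : 0 < η) :
    ∃ᶠ q : E × F in 𝓝 x ×ˢ attentive h (G x), ∃ v ∈ regularSubdiff h q.2,
      ‖ContinuousLinearMap.adjoint (fderiv ℝ G q.1) v - u‖ ≤ η := by
  intro hcon
  obtain ⟨-, z, w, hz, hhz, hw, hwu⟩ := hu
  have hGc : ContinuousAt G x := hG.self_of_nhds.continuousAt
  have ht : Tendsto (fun k => (z k, G (z k))) atTop (𝓝 x ×ˢ attentive h (G x)) :=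
    hz.prodMk (tendsto_attentive_iff.2 ⟨hGc.tendsto.comp hz, hhz⟩)
  have hnear : ∀ᶠ k in atTop, ‖w k - u‖ < η / 2 :=
    (tendsto_iff_norm_sub_tendsto_zero.1 hwu).eventually (gt_mem_nhds (half_pos hη))
  obtain ⟨k, h1, h2, h3, h4⟩ := ((ht.eventually (attentive_prod_eventually hcon)).and
    ((hz.eventually hG.eventually_nhds).and
    (((hGc.tendsto.comp hz).eventually hl.eventually_nhds).and hnear))).exists
  obtain ⟨q, ⟨v, hv, hvw⟩, hq⟩ := ((frequently_chain_of_mem_regularSubdiff h2 h3 (hw k)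
    (half_pos hη)).and_eventually h1).exists
  refine hq ⟨v, hv, ?_⟩
  have := norm_add_le (ContinuousLinearMap.adjoint (fderiv ℝ G q.1) v - w k) (w k - u)
  rw [sub_add_sub_cancel] at this
  linarith

/-- First-order expansion estimates of a map that is `C²` around `x₀`. -/
theorem ContDiffAt.exists_linearization_bounds {c : E → F} {x₀ : E} (hc : ContDiffAt ℝ 2 c x₀) :
    ∃ L : ℝ, 1 ≤ L ∧ ∀ᶠ x in 𝓝 x₀, ‖fderiv ℝ c x - fderiv ℝ c x₀‖ ≤ L * ‖x - x₀‖ ∧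
      ‖fderiv ℝ c x‖ ≤ L ∧ ‖c x + fderiv ℝ c x (x₀ - x) - c x₀‖ ≤ L * ‖x - x₀‖ ^ 2 := by
  have hc1 : ContDiffAt ℝ 1 (fderiv ℝ c) x₀ := hc.fderiv_right (by norm_num)
  obtain ⟨K, s, hs, hK⟩ := hc1.exists_lipschitzOnWith
  have hd : ∀ᶠ x in 𝓝 x₀, DifferentiableAt ℝ c x :=
    (hc.eventually (by simp)).mono fun x hx => hx.differentiableAt (by norm_num)
  obtain ⟨r, hr, hrs⟩ := Metric.nhds_basis_ball.eventually_iff.1 (hd.and hs)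
  have hx₀ : x₀ ∈ s := (hrs (Metric.mem_ball_self hr)).2
  set L : ℝ := max 1 (max (2 * K) (‖fderiv ℝ c x₀‖ + 1)) with hL
  have hLK : 2 * (K : ℝ) ≤ L := le_max_of_le_right (le_max_left _ _)
  have hK0 : (0 : ℝ) ≤ K := K.2
  have hcb : ∀ᶠ x in 𝓝 x₀, ‖fderiv ℝ c x‖ < ‖fderiv ℝ c x₀‖ + 1 :=
    hc1.continuousAt.norm.eventually (gt_mem_nhds (by simp))
  refine ⟨L, le_max_left _ _, ?_⟩
  filter_upwards [Metric.ball_mem_nhds x₀ hr, hcb] with x hx hxb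
  have hlip : ∀ y ∈ s, ∀ z ∈ s, ‖fderiv ℝ c y - fderiv ℝ c z‖ ≤ K * ‖y - z‖ := fun y hy z hz =>
    hK.norm_sub_le hy hz
  refine ⟨?_, hxb.le.trans (le_max_of_le_right (le_max_right _ _)), ?_⟩
  · refine (hlip x (hrs hx).2 x₀ hx₀).trans ?_
    gcongr
    linarith
  · have hsub : Metric.closedBall x₀ ‖x - x₀‖ ⊆ Metric.ball x₀ r :=
      Metric.closedBall_subset_ball (by simpa [dist_eq_norm] using hx)
    -- On this ball `‖z - x‖ ≤ 2‖x - x₀‖`, so the derivative varies from its value at `x` by at most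
    -- `2K‖x - x₀‖`.
    have hmv := Convex.norm_image_sub_le_of_norm_fderiv_le' (𝕜 := ℝ) (f := c)
      (s := Metric.closedBall x₀ ‖x - x₀‖) (x := x₀) (y := x) (φ := fderiv ℝ c x)
      (C := 2 * K * ‖x - x₀‖) (fun z hz => (hrs (hsub hz)).1) (fun z hz => ?_)
      (convex_closedBall _ _) (Metric.mem_closedBall_self (norm_nonneg _))
      (by simp [dist_eq_norm])
    · have heq : c x + fderiv ℝ c x (x₀ - x) - c x₀ = c x - c x₀ - fderiv ℝ c x (x - x₀) := by
        rw [← neg_sub x x₀, map_neg]; abel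
      rw [heq]
      refine hmv.trans ?_
      rw [mul_assoc, ← sq]
      gcongr
    · refine (hlip z (hrs (hsub hz)).2 x (hrs hx).2).trans ?_
      rw [Metric.mem_closedBall, dist_eq_norm] at hz
      have h1 : ‖z - x‖ ≤ ‖z - x₀‖ + ‖x - x₀‖ := by
        rw [← sub_sub_sub_cancel_right z x x₀]; exact norm_sub_le _ _
      nlinarith

/-- Quadratic lower bound for the linearized values, from a multiplier `v` with
`(∇c(x₀))^* v = 0`. -/
theorem exists_linearized_lower_bound [CompleteSpace E] [CompleteSpace F] {h : F → EReal}
    {c : E → F} {x₀ : E} {a : ℝ}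
    (hc : ContDiffAt ℝ 2 c x₀) {v : F} (hv : ContinuousLinearMap.adjoint (fderiv ℝ c x₀) v = 0)
    {ρ : ℝ} (hρ : 0 ≤ ρ) (hlow : ∀ᶠ z in 𝓝 (c x₀),
      ((a + inner ℝ v (z - c x₀) - ρ / 2 * ‖z - c x₀‖ ^ 2 : ℝ) : EReal) ≤ h z) :
    ∃ K : ℝ, 0 ≤ K ∧ ∀ᶠ p : E × E in 𝓝 (x₀, 0),
      ((a - K * (‖p.1 - x₀‖ + ‖p.2‖) ^ 2 : ℝ) : EReal) ≤ h (c p.1 + fderiv ℝ c p.1 p.2) := by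
  obtain ⟨L, hL, hb⟩ := hc.exists_linearization_bounds
  have hb' : ∀ᶠ p : E × E in 𝓝 (x₀, 0), ‖fderiv ℝ c p.1 - fderiv ℝ c x₀‖ ≤ L * ‖p.1 - x₀‖ ∧
      ‖fderiv ℝ c p.1‖ ≤ L ∧ ‖c p.1 + fderiv ℝ c p.1 (x₀ - p.1) - c x₀‖ ≤ L * ‖p.1 - x₀‖ ^ 2 :=
    hb.prod_inl_nhds 0
  have hcont : ContinuousAt (fun p : E × E => c p.1 + fderiv ℝ c p.1 p.2) (x₀, 0) := by
    have h1 : ContinuousAt (fderiv ℝ c) x₀ :=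
      (hc.fderiv_right (m := 1) (by norm_num)).continuousAt
    exact (hc.continuousAt.comp' (f := Prod.fst) (x := (x₀, (0 : E))) continuousAt_fst).add
      ((h1.comp' (f := Prod.fst) (x := (x₀, (0 : E))) continuousAt_fst).clm_apply continuousAt_snd)
  have hlow' := (show Tendsto _ _ (𝓝 (c x₀)) by simpa using hcont.tendsto).eventually hlow
  have hone : ∀ᶠ p : E × E in 𝓝 (x₀, 0), ‖p.1 - x₀‖ < 1 := by
    have : Continuous fun p : E × E => ‖p.1 - x₀‖ := by fun_prop
    exact (this.tendsto' (x₀, 0) 0 (by simp)).eventually (gt_mem_nhds one_pos)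
  refine ⟨‖v‖ * (2 * L) + ρ / 2 * (2 * L) ^ 2, by positivity, ?_⟩
  filter_upwards [hb', hlow', hone] with ⟨x, d⟩ ⟨h1, h2, h3⟩ h4 h5
  refine le_trans (EReal.coe_le_coe_iff.2 ?_) h4
  simp only at h1 h2 h3 h5 ⊢
  set s := ‖x - x₀‖
  have hs : 0 ≤ s := norm_nonneg _
  have hd : 0 ≤ ‖d‖ := norm_nonneg _
  set R := c x + fderiv ℝ c x (x₀ - x) - c x₀ with hR
  set w := (x - x₀) + d with hw
  have hws : ‖w‖ ≤ s + ‖d‖ := norm_add_le _ _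
  have hz : c x + fderiv ℝ c x d - c x₀ = R + fderiv ℝ c x w := by
    rw [hR, hw, map_add, ← neg_sub x x₀, map_neg]; abel
  have hs2 : s ^ 2 ≤ s * (s + ‖d‖) := by nlinarith
  have hs3 : s ^ 2 ≤ s + ‖d‖ := by nlinarith
  have hn : ‖c x + fderiv ℝ c x d - c x₀‖ ≤ 2 * L * (s + ‖d‖) := by
    rw [hz]
    have h6 : ‖fderiv ℝ c x w‖ ≤ L * (s + ‖d‖) :=
      (ContinuousLinearMap.le_opNorm _ _).trans (mul_le_mul h2 hws (norm_nonneg _) (by linarith))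
    refine (norm_add_le _ _).trans ?_
    nlinarith
  -- Because `v` annihilates the range of `∇c(x₀)`, only `R` and the variation of the derivative
  -- applied to `w` contribute, and both are of second order.
  have hi : -(‖v‖ * (2 * L) * (s + ‖d‖) ^ 2) ≤ inner ℝ v (c x + fderiv ℝ c x d - c x₀) := by
    have h6 : inner ℝ v (fderiv ℝ c x₀ w) = 0 := by
      rw [← ContinuousLinearMap.adjoint_inner_left, hv, inner_zero_left]
    have h7 : inner ℝ v (c x + fderiv ℝ c x d - c x₀) =
        inner ℝ v (R + (fderiv ℝ c x - fderiv ℝ c x₀) w) := by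
      rw [hz, sub_apply, inner_add_right v R, inner_add_right v R,
        inner_sub_right v (fderiv ℝ c x w), h6, sub_zero]
    have h8 : ‖R + (fderiv ℝ c x - fderiv ℝ c x₀) w‖ ≤ 2 * L * (s + ‖d‖) ^ 2 := by
      have h9 : ‖(fderiv ℝ c x - fderiv ℝ c x₀) w‖ ≤ L * s * (s + ‖d‖) :=
        (ContinuousLinearMap.le_opNorm _ _).trans
          (mul_le_mul h1 hws (norm_nonneg _) (by positivity))
      refine (norm_add_le _ _).trans ?_
      nlinarith [mul_nonneg hd (add_nonneg hs hd)]
    rw [h7]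
    have h10 := neg_le_of_abs_le (abs_real_inner_le_norm v (R + (fderiv ℝ c x - fderiv ℝ c x₀) w))
    nlinarith [mul_le_mul_of_nonneg_left h8 (norm_nonneg v)]
  have hsq : ‖c x + fderiv ℝ c x d - c x₀‖ ^ 2 ≤ (2 * L * (s + ‖d‖)) ^ 2 := by gcongr
  nlinarith

end ProxRegularComposite

/-! ### Trial steps by exact penalization. -/

section TrialStep

variable {E F : Type*} [NormedAddCommGroup E] [InnerProductSpace ℝ E]
  [NormedAddCommGroup F] [InnerProductSpace ℝ F]

/-- From `2‖g‖‖g + e‖ ≤ ‖g‖² + ‖g + e‖²`. Away from zero residual this lets the norm penalty enter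
quadratic subgradient estimates. -/
theorem norm_add_le_quadratic {g : F} (hg : g ≠ 0) (e : F) :
    ‖g + e‖ ≤ ‖g‖ + inner ℝ (‖g‖⁻¹ • g) e + (2 * ‖g‖)⁻¹ * ‖e‖ ^ 2 := by
  have hpos : 0 < ‖g‖ := norm_pos_iff.2 hg
  have h1 := norm_add_sq_real g e
  have h2 := two_mul_le_add_sq ‖g‖ ‖g + e‖
  rw [inner_smul_left]
  simp only [conj_trivial]
  have h3 : ‖g‖ + ‖g‖⁻¹ * inner ℝ g e + (2 * ‖g‖)⁻¹ * ‖e‖ ^ 2 =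
      (2 * ‖g‖ ^ 2 + 2 * inner ℝ g e + ‖e‖ ^ 2) / (2 * ‖g‖) := by
    field_simp
  rw [h3, le_div_iff₀ (by positivity)]
  linarith

/-- Exact penalization: an affine map `d ↦ b + T d` that almost hits `y₀` at `d₀`
can be corrected, at a cost proportional to the residual, so as to reach points where `h` is
almost at most `h y₀`. -/
theorem exists_correction_of_residual [ProperSpace E] [ProperSpace F] {h : F → EReal}
    {y₀ v b : F} {T : E →L[ℝ] F} {d₀ : E} {a r r' ρ B K : ℝ} (ha : h y₀ = a)
    (hr : 0 < r) (hr' : r' ≤ 1) (hρ : 0 < ρ)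
    (hl : ∀ y ∈ Metric.closedBall y₀ r, LowerSemicontinuousAt h y)
    (hlow : ∀ y ∈ Metric.closedBall y₀ r,
      ((a + inner ℝ v (y - y₀) - ρ / 2 * ‖y - y₀‖ ^ 2 : ℝ) : EReal) ≤ h y)
    (hvr : ‖v‖ * r + ρ / 2 * r ^ 2 < r' / 2)
    (hB : ∀ y ∈ Metric.ball y₀ r, ((a - r' : ℝ) : EReal) < h y → h y < ((a + r' : ℝ) : EReal) →
      ∀ w ∈ regularSubdiff h y,
        ‖ContinuousLinearMap.adjoint T w‖ ≤ 1 + ‖T‖ * (‖v‖ + 2 * ρ * r) → ‖w‖ ≤ B)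
    (hK : B + ‖v‖ + 2 * ρ * r < K) (hK0 : 0 ≤ K)
    (hres : K * ‖y₀ - b - T d₀‖ < r' / 2) (hres' : K * ‖y₀ - b - T d₀‖ < ρ / 2 * r ^ 2) :
    ∃ d : E, ‖d - d₀‖ ≤ K * ‖y₀ - b - T d₀‖ ∧
      h (b + T d) ≤ ((a + K * ‖y₀ - b - T d₀‖ + ‖v‖ * ‖b + T d - y₀‖ : ℝ) : EReal) := by
  set e : ℝ := ‖y₀ - b - T d₀‖ with he
  have he0 : 0 ≤ K * e := mul_nonneg hK0 (norm_nonneg _)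
  have hinner : ∀ y ∈ Metric.closedBall y₀ r, |(inner ℝ v (y - y₀) : ℝ)| ≤ ‖v‖ * r := by
    intro y hy
    rw [Metric.mem_closedBall, dist_eq_norm] at hy
    exact (abs_real_inner_le_norm _ _).trans (mul_le_mul_of_nonneg_left hy (norm_nonneg _))
  have hquad : ∀ y ∈ Metric.closedBall y₀ r, ρ / 2 * ‖y - y₀‖ ^ 2 ≤ ρ / 2 * r ^ 2 := by
    intro y hy
    rw [Metric.mem_closedBall, dist_eq_norm] at hy
    gcongr
  have hlow' : ∀ y ∈ Metric.closedBall y₀ r, ((a - r' / 2 : ℝ) : EReal) < h y := by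
    intro y hy
    refine lt_of_lt_of_le (EReal.coe_lt_coe_iff.2 ?_) (hlow y hy)
    linarith [neg_le_of_abs_le (hinner y hy), hquad y hy]
  have hlow1 : ∀ y ∈ Metric.closedBall y₀ r, ((a - 1 : ℝ) : EReal) ≤ h y := fun y hy =>
    le_trans (EReal.coe_le_coe_iff.2 (by linarith)) (hlow' y hy).le
  set H : F → ℝ := fun y => clampAround a (h y) with hH
  have hHlow : ∀ y ∈ Metric.closedBall y₀ r,
      a + inner ℝ v (y - y₀) - ρ / 2 * ‖y - y₀‖ ^ 2 ≤ H y := by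
    intro y hy
    refine le_clampAround ?_ (hlow y hy)
    have : 0 ≤ ρ / 2 * ‖y - y₀‖ ^ 2 := by positivity
    have : 0 ≤ ρ / 2 * r ^ 2 := by positivity
    linarith [le_of_abs_le (hinner y hy)]
  -- The extra `1` keeps the minimizing `d` interior, as `‖d - d₀‖ ≤ K * e` will follow.
  set Q : Set (E × F) := Metric.closedBall d₀ (K * e + 1) ×ˢ Metric.closedBall y₀ r with hQ
  have hQc : IsCompact Q := (isCompact_closedBall _ _).prod (isCompact_closedBall _ _)
  -- Subtracting the tilt and adding twice the prox-regularity quadratic leaves at least `(ρ/2)‖y -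
  -- y₀‖²` besides the penalty and the distance. Comparison with `Φ (d₀, y₀) = K * e` then localizes
  -- the minimizer.
  set Φ : E × F → ℝ := fun p => H p.2 +
    (K * ‖p.2 - b - T p.1‖ + ‖p.1 - d₀‖ - a - inner ℝ v (p.2 - y₀) + ρ * ‖p.2 - y₀‖ ^ 2) with hΦ
  have hΦlsc : LowerSemicontinuousOn Φ Q := by
    have hHlsc : LowerSemicontinuousOn H (Metric.closedBall y₀ r) := fun y hy =>
      (lowerSemicontinuousAt_clampAround (hl y hy) a).lowerSemicontinuousWithinAt _
    refine LowerSemicontinuousOn.add (hHlsc.comp continuousOn_snd fun p hp => hp.2)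
      (ContinuousOn.lowerSemicontinuousOn (Continuous.continuousOn ?_))
    fun_prop
  have h0Q : (d₀, y₀) ∈ Q :=
    ⟨Metric.mem_closedBall_self (by linarith), Metric.mem_closedBall_self hr.le⟩
  have hΦ0 : Φ (d₀, y₀) = K * e := by
    simp [hΦ, hH, ha, clampAround_self, he]
  obtain ⟨⟨d, y⟩, hp, hmin⟩ := hΦlsc.exists_isMinOn ⟨_, h0Q⟩ hQc
  have hle : Φ (d, y) ≤ K * e := hΦ0 ▸ hmin h0Q
  set g : F := y - b - T d with hg
  have hyl := hHlow y hp.2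
  simp only [hΦ] at hle
  have hKg : 0 ≤ K * ‖g‖ := mul_nonneg hK0 (norm_nonneg _)
  have hdd : ‖d - d₀‖ ≤ K * e := by
    have : 0 ≤ ρ * ‖y - y₀‖ ^ 2 := by positivity
    linarith
  have hyr : ‖y - y₀‖ < r := by
    refine lt_of_pow_lt_pow_left₀ 2 hr.le ?_
    have : 0 ≤ ‖d - d₀‖ := norm_nonneg _
    have : ρ / 2 * ‖y - y₀‖ ^ 2 < ρ / 2 * r ^ 2 := by linarith
    exact lt_of_mul_lt_mul_left this (by positivity)
  have hHy : H y ≤ a + K * e + inner ℝ v (y - y₀) := by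
    have : 0 ≤ ρ * ‖y - y₀‖ ^ 2 := by positivity
    linarith [norm_nonneg (d - d₀)]
  have hHy' : H y < a + r' := by
    have : 0 ≤ ρ / 2 * r ^ 2 := by positivity
    linarith [le_of_abs_le (hinner y hp.2)]
  have hy : h y = H y := eq_clampAround_of_lt (hlow1 y hp.2) (by linarith)
  by_cases hg0 : g = 0
  · have hyT : b + T d = y := by
      rw [hg, sub_sub, sub_eq_zero] at hg0; exact hg0.symm
    refine ⟨d, hdd, ?_⟩
    rw [hyT, hy, EReal.coe_le_coe_iff]
    linarith [real_inner_le_norm v (y - y₀)]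
  -- With nonzero residual, optimality in `y` produces the subgradient `w`, and optimality in `d`
  -- bounds `T^*(K • p)` by `1`. So `‖w‖ ≤ B`, which is incompatible with `‖K • p‖ = K`.
  exfalso
  have hgpos : 0 < ‖g‖ := norm_pos_iff.2 hg0
  have hyb : y ∈ Metric.ball y₀ r := by rwa [Metric.mem_ball, dist_eq_norm]
  set p : F := ‖g‖⁻¹ • g with hpdef
  have hpn : ‖p‖ = 1 := by simp [hpdef, norm_smul, hgpos.ne']
  set w : F := v - (2 * ρ) • (y - y₀) - K • p with hw
  have hwreg : w ∈ regularSubdiff h y := by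
    refine mem_regularSubdiff_of_quadratic hy (ρ + K * (2 * ‖g‖)⁻¹) ?_
    filter_upwards [Metric.isOpen_ball.mem_nhds hyb] with y' hy'
    have hy'c := Metric.ball_subset_closedBall hy'
    refine le_trans ?_ (clampAround_le (hlow1 y' hy'c))
    rw [EReal.coe_le_coe_iff]
    have h1 : Φ (d, y) ≤ Φ (d, y') := hmin (⟨hp.1, hy'c⟩ : (d, y') ∈ Q)
    simp only [hΦ] at h1
    have h2 : ‖y' - y₀‖ ^ 2 = ‖y - y₀‖ ^ 2 + 2 * inner ℝ (y - y₀) (y' - y) + ‖y' - y‖ ^ 2 := by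
      rw [← norm_add_sq_real]; congr 2; abel
    have h3 := mul_le_mul_of_nonneg_left (norm_add_le_quadratic hg0 (y' - y)) hK0
    have h4 : g + (y' - y) = y' - b - T d := by rw [hg]; abel
    have h5 : inner ℝ v (y' - y₀) = inner ℝ v (y - y₀) + inner ℝ v (y' - y) := by
      rw [← inner_add_right]; congr 1; abel
    rw [h4] at h3
    change _ ≤ H y'
    rw [hw, inner_sub_left, inner_sub_left, inner_smul_left, inner_smul_left]
    simp only [conj_trivial]
    rw [h2, h5] at h1
    nlinarith
  have hq : ‖ContinuousLinearMap.adjoint T (-(K • p))‖ ≤ 1 := by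
    refine norm_le_of_eventually_inner_ge zero_le_one fun ε hε => ?_
    have hsmall : ∀ᶠ u in 𝓝 (0 : E), K * ((2 * ‖g‖)⁻¹ * ‖T‖ ^ 2) * ‖u‖ < ε := by
      have : Continuous fun u : E => K * ((2 * ‖g‖)⁻¹ * ‖T‖ ^ 2) * ‖u‖ := by fun_prop
      exact (this.tendsto' 0 0 (by simp)).eventually (gt_mem_nhds hε)
    have hball : ∀ᶠ u in 𝓝 (0 : E), d + u ∈ Metric.closedBall d₀ (K * e + 1) := by
      have h1 : Continuous fun u : E => d + u := by fun_prop
      refine ((h1.tendsto' 0 d (by simp)).eventually (Metric.isOpen_ball.mem_nhds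
        (show d ∈ Metric.ball d₀ (K * e + 1) from ?_))).mono
        fun u hu => Metric.ball_subset_closedBall hu
      rw [Metric.mem_ball, dist_eq_norm]; linarith
    filter_upwards [hsmall, hball] with u hu hub
    have h1 : Φ (d, y) ≤ Φ (d + u, y) := hmin (⟨hub, hp.2⟩ : (d + u, y) ∈ Q)
    simp only [hΦ] at h1
    have h2 := mul_le_mul_of_nonneg_left (norm_add_le_quadratic hg0 (-T u)) hK0
    have h3 : y - b - T (d + u) = g + -T u := by rw [hg, map_add]; abel
    have h4 : ‖d + u - d₀‖ ≤ ‖d - d₀‖ + ‖u‖ := by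
      rw [add_sub_right_comm]; exact norm_add_le _ _
    have h5 : ‖-T u‖ ^ 2 ≤ ‖T‖ ^ 2 * ‖u‖ ^ 2 := by
      rw [norm_neg, ← mul_pow]
      exact pow_le_pow_left₀ (norm_nonneg _) (T.le_opNorm u) 2
    have h6 : K * ((2 * ‖g‖)⁻¹ * ‖-T u‖ ^ 2) ≤ ε * ‖u‖ := by
      calc K * ((2 * ‖g‖)⁻¹ * ‖-T u‖ ^ 2) ≤ K * ((2 * ‖g‖)⁻¹ * (‖T‖ ^ 2 * ‖u‖ ^ 2)) := by gcongr
        _ = K * ((2 * ‖g‖)⁻¹ * ‖T‖ ^ 2) * ‖u‖ * ‖u‖ := by ring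
        _ ≤ ε * ‖u‖ := by gcongr
    rw [h3] at h1
    rw [ContinuousLinearMap.adjoint_inner_left, inner_neg_left, inner_smul_left]
    simp only [conj_trivial]
    rw [inner_neg_right] at h2
    nlinarith
  have hadj : ‖ContinuousLinearMap.adjoint T w‖ ≤ 1 + ‖T‖ * (‖v‖ + 2 * ρ * r) := by
    have h1 : w = -(K • p) + (v - (2 * ρ) • (y - y₀)) := by rw [hw]; abel
    have h2 : ‖v - (2 * ρ) • (y - y₀)‖ ≤ ‖v‖ + 2 * ρ * r := by
      refine (norm_sub_le _ _).trans ?_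
      rw [norm_smul, Real.norm_of_nonneg (by positivity)]
      gcongr
    rw [h1, map_add]
    refine (norm_add_le _ _).trans (add_le_add hq ?_)
    refine (ContinuousLinearMap.le_opNorm _ _).trans ?_
    rw [LinearIsometryEquiv.norm_map]
    gcongr
  have hwB := hB y hyb
    (lt_of_le_of_lt (EReal.coe_le_coe_iff.2 (by nlinarith [norm_nonneg v, sq_nonneg r]))
      (hlow' y hp.2))
    (by rw [hy, EReal.coe_lt_coe_iff]; exact hHy') w hwreg hadj
  have h1 : K • p = v - (2 * ρ) • (y - y₀) - w := by rw [hw]; abel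
  have h2 : K ≤ ‖v‖ + 2 * ρ * r + ‖w‖ := by
    have h3 : ‖K • p‖ = K := by rw [norm_smul, hpn, mul_one, Real.norm_of_nonneg hK0]
    rw [← h3, h1]
    refine (norm_sub_le _ _).trans (add_le_add_left ((norm_sub_le _ _).trans ?_) _)
    rw [norm_smul, Real.norm_of_nonneg (by positivity)]
    gcongr
  linarith

/-- Under transversality, there are trial steps of size `O(‖x - x₀‖)` at which the linearized
value exceeds `h (c x₀)` by at most `O(‖x - x₀‖²)`. -/
theorem exists_trial_step [ProperSpace E] [ProperSpace F] {h : F → EReal} {c : E → F} {x₀ : E}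
    {a : ℝ} (ha : h (c x₀) = a) (hl : ∀ᶠ y in 𝓝 (c x₀), LowerSemicontinuousAt h y)
    (hc : ContDiffAt ℝ 2 c x₀)
    (hB : ∀ C : ℝ, ∃ B : ℝ, ∀ᶠ p : E × F in 𝓝 x₀ ×ˢ attentive h (c x₀),
      ∀ v ∈ regularSubdiff h p.2,
        ‖ContinuousLinearMap.adjoint (fderiv ℝ c p.1) v‖ ≤ C → ‖v‖ ≤ B)
    {v : F} {ρ : ℝ} (hρ : 0 < ρ) (hlow : ∀ᶠ z in 𝓝 (c x₀),
      ((a + inner ℝ v (z - c x₀) - ρ / 2 * ‖z - c x₀‖ ^ 2 : ℝ) : EReal) ≤ h z) :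
    ∃ K : ℝ, 0 ≤ K ∧ ∀ᶠ x in 𝓝 x₀, ∃ d : E, ‖d‖ ≤ K * ‖x - x₀‖ ∧
      h (c x + fderiv ℝ c x d) ≤ ((a + K * ‖x - x₀‖ ^ 2 : ℝ) : EReal) := by
  obtain ⟨L, hL, hLx⟩ := hc.exists_linearization_bounds
  -- This is the adjoint bound of `exists_correction_of_residual`, with `‖T‖ ≤ L` and `r ≤ 1`.
  obtain ⟨B, hBx⟩ := hB (1 + L * (‖v‖ + 2 * ρ))
  obtain ⟨pa, hpa, pb, hpb, hab⟩ := eventually_prod_iff.1 hBx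
  obtain ⟨r₁, hr₁, hr₁b⟩ := (eventually_attentive_iff ha).1 hpb
  set r' : ℝ := min r₁ 1 with hr'def
  have hr'0 : 0 < r' := lt_min hr₁ one_pos
  obtain ⟨r₂, hr₂, hr₂b⟩ := Metric.nhds_basis_closedBall.eventually_iff.1 (hl.and hlow)
  have hsm : ∀ᶠ r : ℝ in 𝓝[>] 0, ‖v‖ * r + ρ / 2 * r ^ 2 < r' / 2 ∧ r < min r₁ (min r₂ 1) := by
    refine Eventually.filter_mono nhdsWithin_le_nhds (Eventually.and ?_ ?_)
    · have : Continuous fun r : ℝ => ‖v‖ * r + ρ / 2 * r ^ 2 := by fun_prop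
      exact (this.tendsto' 0 0 (by simp)).eventually (gt_mem_nhds (by linarith))
    · exact gt_mem_nhds (lt_min hr₁ (lt_min hr₂ one_pos))
  obtain ⟨r, ⟨hvr, hrmin⟩, hr⟩ := (hsm.and self_mem_nhdsWithin).exists
  have hr : 0 < r := hr
  have hrr₁ : r < r₁ := hrmin.trans_le (min_le_left _ _)
  have hrr₂ : r < r₂ := hrmin.trans_le ((min_le_right _ _).trans (min_le_left _ _))
  have hr1 : r < 1 := hrmin.trans_le ((min_le_right _ _).trans (min_le_right _ _))
  set K : ℝ := max B 0 + ‖v‖ + 2 * ρ + 1 with hK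
  have hK0 : 0 ≤ K := by positivity
  have hx2 : ∀ᶠ x in 𝓝 x₀, K * (L * ‖x - x₀‖ ^ 2) < min (r' / 2) (ρ / 2 * r ^ 2) := by
    have : Continuous fun x => K * (L * ‖x - x₀‖ ^ 2) := by fun_prop
    exact (this.tendsto' x₀ 0 (by simp)).eventually (gt_mem_nhds (by positivity))
  have hx1 : ∀ᶠ x in 𝓝 x₀, ‖x - x₀‖ < 1 := by
    have : Continuous fun x => ‖x - x₀‖ := by fun_prop
    exact (this.tendsto' x₀ 0 (by simp)).eventually (gt_mem_nhds one_pos)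
  refine ⟨1 + K * L + ‖v‖ * ((1 + L * K) * L), by positivity, ?_⟩
  filter_upwards [hpa, hLx, hx1, hx2] with x hxa ⟨_, hL2, hL3⟩ hs1 hs2
  set s := ‖x - x₀‖ with hs
  have hs0 : 0 ≤ s := norm_nonneg _
  set e := ‖c x₀ - c x - fderiv ℝ c x (x₀ - x)‖ with he
  have heq : e = ‖c x + fderiv ℝ c x (x₀ - x) - c x₀‖ := by
    rw [he, ← norm_neg]; congr 1; abel
  have heL : e ≤ L * s ^ 2 := heq ▸ hL3
  have hKe : K * e ≤ K * (L * s ^ 2) := mul_le_mul_of_nonneg_left heL hK0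
  -- The starting step `x₀ - x` has residual at most `L * s ^ 2`.
  obtain ⟨d, hd1, hd2⟩ := exists_correction_of_residual (h := h) (y₀ := c x₀) (v := v) (b := c x)
    (T := fderiv ℝ c x) (d₀ := x₀ - x) (r := r) (r' := r') (ρ := ρ) (B := B) (K := K) ha hr
    (min_le_right _ _) hρ
    (fun y hy => (hr₂b (Metric.closedBall_subset_closedBall hrr₂.le hy)).1)
    (fun y hy => (hr₂b (Metric.closedBall_subset_closedBall hrr₂.le hy)).2) hvr
    (fun y hy h1 h2 w hw hwT => by
      refine hab hxa (hr₁b y ((Metric.mem_ball.1 hy).trans hrr₁) ?_ ?_) w hw (hwT.trans ?_)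
      · exact lt_of_le_of_lt (EReal.coe_le_coe_iff.2 (by linarith [min_le_left r₁ 1])) h1
      · exact lt_of_lt_of_le h2 (EReal.coe_le_coe_iff.2 (by linarith [min_le_left r₁ 1]))
      · have : ‖v‖ + 2 * ρ * r ≤ ‖v‖ + 2 * ρ := by nlinarith
        gcongr)
    (by nlinarith [le_max_left B 0]) hK0
    (hKe.trans_lt (hs2.trans_le (min_le_left _ _)))
    (hKe.trans_lt (hs2.trans_le (min_le_right _ _)))
  refine ⟨d, ?_, hd2.trans (EReal.coe_le_coe_iff.2 ?_)⟩
  · have h1 : ‖d‖ ≤ ‖d - (x₀ - x)‖ + ‖x₀ - x‖ := by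
      simpa using norm_add_le (d - (x₀ - x)) (x₀ - x)
    rw [norm_sub_rev x₀ x] at h1
    have h2 : K * (L * s ^ 2) ≤ K * L * s := by
      have : s ^ 2 ≤ s := by nlinarith
      calc K * (L * s ^ 2) ≤ K * (L * s) := by gcongr
        _ = K * L * s := by ring
    have h3 : 0 ≤ ‖v‖ * ((1 + L * K) * L) * s := by positivity
    nlinarith
  · have h1 : c x + fderiv ℝ c x d - c x₀ =
        (c x + fderiv ℝ c x (x₀ - x) - c x₀) + fderiv ℝ c x (d - (x₀ - x)) := by
      rw [map_sub (fderiv ℝ c x) d]; abel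
    have h2 : ‖c x + fderiv ℝ c x d - c x₀‖ ≤ (1 + L * K) * L * s ^ 2 := by
      rw [h1]
      have h3 : ‖fderiv ℝ c x (d - (x₀ - x))‖ ≤ L * (K * (L * s ^ 2)) :=
        (ContinuousLinearMap.le_opNorm _ _).trans
          (mul_le_mul hL2 (hd1.trans hKe) (norm_nonneg _) (by linarith))
      refine (norm_add_le _ _).trans ?_
      nlinarith
    have h3 := mul_le_mul_of_nonneg_left h2 (norm_nonneg v)
    have h4 : a + (1 + K * L + ‖v‖ * ((1 + L * K) * L)) * s ^ 2 =
        a + K * (L * s ^ 2) + ‖v‖ * ((1 + L * K) * L * s ^ 2) + s ^ 2 := by ring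
    rw [h4]
    linarith [sq_nonneg s]

end TrialStep

/-! ### Existence, convergence and descent of the proximal step. -/

section ProximalStep

theorem EReal.coe_sub_le_of_coe_le_add {p r : ℝ} {t : EReal} (h : (p : EReal) ≤ t + (r : EReal)) :
    ((p - r : ℝ) : EReal) ≤ t := by
  induction t with
  | bot => simp at h
  | coe t =>
    rw [← EReal.coe_add, EReal.coe_le_coe_iff] at h
    rw [EReal.coe_le_coe_iff]
    linarith
  | top => exact le_top

/-- This half of the chain rule needs no qualification: `‖G z - G x‖ = O(‖z - x‖)` absorbs the error
term. -/
theorem adjoint_mem_regularSubdiff_comp {E F : Type*} [NormedAddCommGroup E]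
    [InnerProductSpace ℝ E] [NormedAddCommGroup F] [InnerProductSpace ℝ F] [CompleteSpace E]
    [CompleteSpace F] {h : F → EReal} {G : E → F} {x : E} (hG : DifferentiableAt ℝ G x) {v : F}
    (hv : v ∈ regularSubdiff h (G x)) :
    ContinuousLinearMap.adjoint (fderiv ℝ G x) v ∈ regularSubdiff (fun z => h (G z)) x := by
  refine ⟨hv.1, fun ε hε => ?_⟩
  obtain ⟨M, hM0, hM⟩ := hG.isBigO_sub.exists_pos
  have hlit := hG.hasFDerivAt.isLittleO.def (show 0 < ε / (2 * (‖v‖ + 1)) by positivity)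
  filter_upwards [hM.bound, hlit,
    hG.continuousAt.eventually (hv.2 (ε / (2 * M)) (by positivity))] with z h1 h2 h3
  refine le_trans ?_ h3
  refine add_le_add le_rfl (EReal.coe_le_coe_iff.2 ?_)
  rw [ContinuousLinearMap.adjoint_inner_left]
  have h4 : inner ℝ v (G z - G x) = inner ℝ v (fderiv ℝ G x (z - x)) +
      inner ℝ v (G z - G x - fderiv ℝ G x (z - x)) := by
    rw [← inner_add_right, add_sub_cancel]
  have h5 := neg_le_of_abs_le (abs_real_inner_le_norm v (G z - G x - fderiv ℝ G x (z - x)))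
  have h6 : ‖v‖ * ‖G z - G x - fderiv ℝ G x (z - x)‖ ≤ ε / 2 * ‖z - x‖ := by
    calc ‖v‖ * ‖G z - G x - fderiv ℝ G x (z - x)‖
        ≤ (‖v‖ + 1) * (ε / (2 * (‖v‖ + 1)) * ‖z - x‖) := by gcongr; linarith
      _ = ε / 2 * ‖z - x‖ := by field_simp
  have h7 : ε / (2 * M) * ‖G z - G x‖ ≤ ε / 2 * ‖z - x‖ := by
    calc ε / (2 * M) * ‖G z - G x‖ ≤ ε / (2 * M) * (M * ‖z - x‖) := by gcongr
      _ = ε / 2 * ‖z - x‖ := by field_simp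
  linarith

/-- Regular subgradients of the linearized composites near `(x₀, h (c x₀))` have multipliers at
which the prox-regularity inequality holds uniformly. -/
theorem exists_uniform_multipliers {E F : Type*} [NormedAddCommGroup E] [InnerProductSpace ℝ E]
    [NormedAddCommGroup F] [InnerProductSpace ℝ F] [ProperSpace E] [ProperSpace F]
    {h : F → EReal} {c : E → F} {x₀ : E} (hprox : ProxRegularAt h (c x₀))
    (hB : ∀ C : ℝ, ∃ B : ℝ, ∀ᶠ p : E × F in 𝓝 x₀ ×ˢ attentive h (c x₀),
      ∀ v ∈ regularSubdiff h p.2,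
        ‖ContinuousLinearMap.adjoint (fderiv ℝ c p.1) v‖ ≤ C → ‖v‖ ≤ B) :
    ∃ ρ : ℝ, 0 < ρ ∧ ∃ Z ∈ 𝓝 (c x₀), IsOpen Z ∧ ∀ᶠ p : E × F in 𝓝 x₀ ×ˢ attentive h (c x₀),
      ∀ d u : E, c p.1 + fderiv ℝ c p.1 d = p.2 →
        u ∈ regularSubdiff (fun e => h (c p.1 + fderiv ℝ c p.1 e)) d → ‖u‖ ≤ 1 →
        ∃ v : F, ContinuousLinearMap.adjoint (fderiv ℝ c p.1) v = u ∧ ∀ z ∈ Z,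
          h p.2 + ((inner ℝ v (z - p.2) - ρ / 2 * ‖z - p.2‖ ^ 2 : ℝ) : EReal) ≤ h z := by
  -- Here `2` covers `‖u‖ + 1` for `‖u‖ ≤ 1`.
  obtain ⟨B, hBx⟩ := hB 2
  obtain ⟨ρ, hρ, hρx⟩ := hprox.eventually_of_norm_le B
  obtain ⟨pa, hpa, pb, hpb, hab⟩ := eventually_prod_iff.1 hBx
  obtain ⟨qa, hqa, qb, hqb, hq⟩ := eventually_prod_iff.1 hρx
  obtain ⟨Z, hZ, hZo, hZx⟩ := eventually_nhds_iff.1 hqb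
  refine ⟨ρ, hρ, Z, hZo.mem_nhds hZx, hZo, ?_⟩
  have hl : ∀ᶠ y in attentive h (c x₀), ∀ᶠ z in 𝓝 y, LowerSemicontinuousAt h z :=
    attentive_le_nhds _ _ hprox.2.1.eventually_nhds
  refine eventually_prod_iff.2 ⟨pa, hpa, _,
    (attentive_eventually_attentive hpb).and (hqa.and hl), ?_⟩
  rintro x hx y ⟨hyb, hya, hyl⟩ d u hd hu hu1
  simp only at hd hu ⊢
  have hder : ∀ e, fderiv ℝ (fun e => c x + fderiv ℝ c x e) e = fderiv ℝ c x := by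
    intro e
    rw [fderiv_const_add, ContinuousLinearMap.fderiv]
  have hy : FiniteAt h y := hd ▸ hu.1
  -- The point `x` is frozen, so the inner map is affine with constant derivative and only `y`
  -- varies.
  obtain ⟨v, hv, hvB, hvu⟩ := exists_mem_subdiff_adjoint_eq (h := h) (A := fun _ => fderiv ℝ c x)
    (x := d) (u := u) (y := y) (B := B) hy continuousAt_const
    (fun η hη => by
      have := frequently_chain_of_mem_regularSubdiff (h := h)
        (G := fun e => c x + fderiv ℝ c x e) (x := d) (u := u)
        (Eventually.of_forall fun z => by fun_prop) (by rwa [hd]) hu hη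
      simpa only [hder, hd] using this)
    (by
      refine eventually_prod_iff.2 ⟨fun _ => True, univ_mem, pb, hyb, ?_⟩
      intro _ _ y' hy' w hw hwu
      exact hab hx hy' w hw (hwu.trans (by linarith)))
  exact ⟨v, hvu, fun z hz => hq hya (hZ z hz) v hv hvB⟩

variable {n m : ℕ} {h : EuclideanSpace ℝ (Fin m) → EReal}
  {c : EuclideanSpace ℝ (Fin n) → EuclideanSpace ℝ (Fin m)}
  {x₀ : EuclideanSpace ℝ (Fin n)}

theorem proxLin_finite_iff {x d : EuclideanSpace ℝ (Fin n)} {μ : ℝ} :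
    FiniteAt (proxLin h c x μ) d ↔ FiniteAt (linValue h c x) d := by
  unfold FiniteAt proxLin
  generalize μ / 2 * ‖d‖ ^ 2 = s
  induction linValue h c x d with
  | bot => simp
  | coe t => rw [← EReal.coe_add]; simp [-EReal.coe_add]
  | top => simp

/-- Fermat's rule: expanding `‖e‖²` about `d` turns minimality into a quadratic minorant with slope
`-(μ • d)`. -/
theorem IsLocalMinimizer.mem_regularSubdiff_linValue {x d : EuclideanSpace ℝ (Fin n)} {μ : ℝ}
    (hd : IsLocalMinimizer (proxLin h c x μ) d) :
    -(μ • d) ∈ regularSubdiff (linValue h c x) d := by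
  obtain ⟨t, ht⟩ := (proxLin_finite_iff.1 hd.1).exists_coe
  refine mem_regularSubdiff_of_quadratic ht (μ / 2) ?_
  filter_upwards [hd.2] with e he
  unfold proxLin at he
  rw [ht, ← EReal.coe_add] at he
  refine le_trans (EReal.coe_le_coe_iff.2 (le_of_eq ?_)) (EReal.coe_sub_le_of_coe_le_add he)
  have h1 : ‖e‖ ^ 2 = ‖d‖ ^ 2 + 2 * inner ℝ d (e - d) + ‖e - d‖ ^ 2 := by
    rw [← norm_add_sq_real, add_sub_cancel]
  rw [h1, inner_neg_left, inner_smul_left]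
  simp only [conj_trivial]
  ring

/-- The proximal step exists with a uniform bound, given a quadratic lower bound on the
linearized values and trial steps of second-order accuracy. -/
theorem isProxStepThreshold_of_bounds {a K μbar : ℝ} (ha : h (c x₀) = a)
    (hl : ∀ᶠ y in 𝓝 (c x₀), LowerSemicontinuousAt h y) (hc : ContDiffAt ℝ 2 c x₀) (hK : 0 ≤ K)
    (hlow : ∀ᶠ p : EuclideanSpace ℝ (Fin n) × EuclideanSpace ℝ (Fin n) in 𝓝 (x₀, 0),
      ((a - K * (‖p.1 - x₀‖ + ‖p.2‖) ^ 2 : ℝ) : EReal) ≤ linValue h c p.1 p.2)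
    (htrial : ∀ᶠ x in 𝓝 x₀, ∃ d : EuclideanSpace ℝ (Fin n), ‖d‖ ≤ K * ‖x - x₀‖ ∧
      linValue h c x d ≤ ((a + K * ‖x - x₀‖ ^ 2 : ℝ) : EReal))
    (hμK : 8 * K + 1 ≤ μbar) :
    IsProxStepThreshold h c x₀ μbar := by
  have hpair : ContinuousAt (fun p : EuclideanSpace ℝ (Fin n) × EuclideanSpace ℝ (Fin n) =>
      c p.1 + fderiv ℝ c p.1 p.2) (x₀, 0) := by
    have h1 : ContinuousAt (fderiv ℝ c) x₀ :=
      (hc.fderiv_right (m := 1) (by norm_num)).continuousAt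
    exact (hc.continuousAt.comp' (f := Prod.fst) (x := (x₀, _)) continuousAt_fst).add
      ((h1.comp' (f := Prod.fst) (x := (x₀, _)) continuousAt_fst).clm_apply continuousAt_snd)
  have hl' := (show Tendsto _ _ (𝓝 (c x₀)) by simpa using hpair.tendsto).eventually hl
  obtain ⟨r, hr, hrp⟩ := Metric.nhds_basis_closedBall.eventually_iff.1 (hlow.and hl')
  obtain ⟨r₁, hr₁, hr₁x⟩ := Metric.nhds_basis_closedBall.eventually_iff.1 htrial
  set R : ℝ := 2 + 2 * K with hR
  have hR0 : 0 < R := by positivity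
  set δ : ℝ := min r (min r₁ (r / (2 * R))) with hδ
  have hδ0 : 0 < δ := lt_min hr (lt_min hr₁ (by positivity))
  have hδR : R * δ < r := by
    have h1 : δ ≤ r / (2 * R) := (min_le_right _ _).trans (min_le_right _ _)
    rw [le_div_iff₀ (by positivity)] at h1
    nlinarith
  have hmem : ∀ {x d}, x ∈ Metric.closedBall x₀ δ → d ∈ Metric.closedBall 0 r →
      (x, d) ∈ Metric.closedBall (x₀, (0 : EuclideanSpace ℝ (Fin n))) r := by
    intro x d hx hd
    rw [← closedBall_prod_same]
    exact ⟨Metric.closedBall_subset_closedBall (min_le_left _ _) hx, hd⟩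
  -- The two upper bounds compare with the zero step and with the trial step; each serves one of the
  -- two alternatives for convergence of the values.
  have hstep : ∀ x ∈ Metric.closedBall x₀ δ, ∀ μ : ℝ, μbar < μ → ∃ d,
      (IsLocalMinimizer (proxLin h c x μ) d ∧ ‖d‖ ≤ R * ‖x - x₀‖) ∧
      proxLin h c x μ d ≤ linValue h c x 0 ∧
      proxLin h c x μ d ≤
        ((a + K * ‖x - x₀‖ ^ 2 + μ / 2 * (K * ‖x - x₀‖) ^ 2 : ℝ) : EReal) := by
    intro x hx μ hμ
    have hμ0 : 0 < μ := by linarith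
    have hs : ‖x - x₀‖ ≤ δ := by simpa [dist_eq_norm] using hx
    obtain ⟨d₁, hd₁, hd₁v⟩ := hr₁x (Metric.closedBall_subset_closedBall
      ((min_le_right _ _).trans (min_le_left _ _)) hx)
    have hd₁r : d₁ ∈ Metric.closedBall (0 : EuclideanSpace ℝ (Fin n)) r := by
      rw [mem_closedBall_zero_iff]
      have h1 : K * ‖x - x₀‖ ≤ R * δ := by gcongr; linarith
      linarith
    have hlsc : LowerSemicontinuousOn (proxLin h c x μ) (Metric.closedBall 0 r) := by
      intro d hd
      have h1 : LowerSemicontinuousAt h (c x + fderiv ℝ c x d) := (hrp (hmem hx hd)).2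
      have h2 : LowerSemicontinuousAt (linValue h c x) d :=
        h1.comp (g := fun d => c x + fderiv ℝ c x d) (by fun_prop)
      have h3 : ContinuousAt
          (fun d : EuclideanSpace ℝ (Fin n) => ((μ / 2 * ‖d‖ ^ 2 : ℝ) : EReal)) d := by
        refine (continuous_coe_real_ereal.comp (?_ : Continuous fun d : EuclideanSpace ℝ (Fin n) =>
          μ / 2 * ‖d‖ ^ 2)).continuousAt
        fun_prop
      exact (h2.add' h3.lowerSemicontinuousAt (EReal.continuousAt_add
        (Or.inr (EReal.coe_ne_bot _)) (Or.inr (EReal.coe_ne_top _)))).lowerSemicontinuousWithinAt _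
    have h0r : (0 : EuclideanSpace ℝ (Fin n)) ∈ Metric.closedBall
        (0 : EuclideanSpace ℝ (Fin n)) r := Metric.mem_closedBall_self hr.le
    obtain ⟨d, hdr, hmin⟩ := hlsc.exists_isMinOn ⟨_, h0r⟩ (isCompact_closedBall _ _)
    have hval : proxLin h c x μ d ≤
        ((a + K * ‖x - x₀‖ ^ 2 + μ / 2 * (K * ‖x - x₀‖) ^ 2 : ℝ) : EReal) := by
      refine (hmin hd₁r).trans ?_
      rw [EReal.coe_add]
      refine add_le_add hd₁v (EReal.coe_le_coe_iff.2 ?_)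
      gcongr
    have hdlow : ((a - K * (‖x - x₀‖ + ‖d‖) ^ 2 : ℝ) : EReal) ≤ linValue h c x d :=
      (hrp (hmem hx hdr)).1
    have hfin : FiniteAt (linValue h c x) d := by
      refine ⟨fun htop => ?_, fun hbot => ?_⟩
      · rw [proxLin, htop, EReal.top_add_coe] at hval
        exact absurd hval (not_le.2 (EReal.coe_lt_top _))
      · rw [hbot] at hdlow
        exact absurd hdlow (not_le.2 (EReal.bot_lt_coe _))
    obtain ⟨t, ht⟩ := hfin.exists_coe
    have hdR : ‖d‖ ≤ R * ‖x - x₀‖ := by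
      rw [proxLin, ht, ← EReal.coe_add, EReal.coe_le_coe_iff] at hval
      rw [ht, EReal.coe_le_coe_iff] at hdlow
      set s := ‖x - x₀‖
      have hs0 : 0 ≤ s := norm_nonneg _
      -- Since `8 * K < μ`, the quadratic loss in `‖d‖` is at most half of the proximal term. The
      -- remaining `μ / 4 * ‖d‖ ^ 2` is compared with multiples of `s ^ 2`, and `R ^ 2` exceeds the
      -- resulting factor.
      have h1 : K * (s + ‖d‖) ^ 2 ≤ K * (2 * s ^ 2 + 2 * ‖d‖ ^ 2) :=
        mul_le_mul_of_nonneg_left (by nlinarith [sq_nonneg (s - ‖d‖)]) hK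
      have h2 : K * ‖d‖ ^ 2 ≤ μ / 8 * ‖d‖ ^ 2 := by gcongr; linarith
      have h3 : K * s ^ 2 ≤ μ / 8 * s ^ 2 := by gcongr; linarith
      have h4 : μ / 4 * ‖d‖ ^ 2 ≤ μ / 4 * ((3 / 2 + 2 * K ^ 2) * s ^ 2) := by nlinarith
      have h5 : ‖d‖ ^ 2 ≤ (3 / 2 + 2 * K ^ 2) * s ^ 2 := le_of_mul_le_mul_left h4 (by positivity)
      refine le_of_sq_le_sq ?_ (by positivity)
      nlinarith [sq_nonneg s, mul_nonneg hK (sq_nonneg s)]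
    have hdint : d ∈ Metric.ball (0 : EuclideanSpace ℝ (Fin n)) r := by
      rw [mem_ball_zero_iff]
      exact (hdR.trans (mul_le_mul_of_nonneg_left hs hR0.le)).trans_lt hδR
    refine ⟨d, ⟨⟨proxLin_finite_iff.2 hfin, ?_⟩, hdR⟩, ?_, hval⟩
    · exact hmin.isLocalMin (mem_of_superset (Metric.isOpen_ball.mem_nhds hdint)
        Metric.ball_subset_closedBall)
    · simpa [proxLin] using hmin h0r
  choose! d hd using hstep
  refine ⟨δ, hδ0, R, hR0.le, d, fun x hx μ hμ => (hd x hx μ hμ).1, ?_⟩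
  intro x μ hx hμ hor
  have hxδ : ∀ᶠ i in atTop, x i ∈ Metric.closedBall x₀ δ :=
    hx.eventually (Metric.closedBall_mem_nhds x₀ hδ0)
  have hs : Tendsto (fun i => ‖x i - x₀‖) atTop (𝓝 0) := tendsto_iff_norm_sub_tendsto_zero.1 hx
  have hlower : Tendsto (fun i => ((a - K * (‖x i - x₀‖ + R * ‖x i - x₀‖) ^ 2 : ℝ) : EReal)) atTop
      (𝓝 (h (c x₀))) := by
    rw [ha]
    refine (continuous_coe_real_ereal.tendsto a).comp ?_
    have : Tendsto (fun i => a - K * (‖x i - x₀‖ + R * ‖x i - x₀‖) ^ 2) atTop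
        (𝓝 (a - K * (0 + R * 0) ^ 2)) :=
      tendsto_const_nhds.sub (((hs.add (hs.const_mul R)).pow 2).const_mul K)
    simpa using this
  have hlb : ∀ᶠ i in atTop, ((a - K * (‖x i - x₀‖ + R * ‖x i - x₀‖) ^ 2 : ℝ) : EReal) ≤
      linValue h c (x i) (d (x i) (μ i)) := by
    filter_upwards [hxδ] with i hi
    obtain ⟨⟨-, h1⟩, -⟩ := hd (x i) hi (μ i) (hμ i)
    have hsδ : ‖x i - x₀‖ ≤ δ := by simpa [dist_eq_norm] using hi
    have hdr : d (x i) (μ i) ∈ Metric.closedBall (0 : EuclideanSpace ℝ (Fin n)) r := by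
      rw [mem_closedBall_zero_iff]
      exact (h1.trans (mul_le_mul_of_nonneg_left hsδ hR0.le)).trans hδR.le
    refine le_trans (EReal.coe_le_coe_iff.2 ?_) (hrp (hmem hi hdr)).1
    simp only
    gcongr
  have hle : ∀ i, linValue h c (x i) (d (x i) (μ i)) ≤
      proxLin h c (x i) (μ i) (d (x i) (μ i)) := fun i => by
    unfold proxLin
    refine le_add_of_nonneg_right (EReal.coe_nonneg.2 ?_)
    have : 0 ≤ μ i := by linarith [hμ i]
    positivity
  rcases hor with hμs | hval
  · have hupper : Tendsto (fun i => ((a + K * ‖x i - x₀‖ ^ 2 +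
        μ i / 2 * (K * ‖x i - x₀‖) ^ 2 : ℝ) : EReal)) atTop (𝓝 (h (c x₀))) := by
      rw [ha]
      refine (continuous_coe_real_ereal.tendsto a).comp ?_
      have : Tendsto (fun i => a + K * ‖x i - x₀‖ ^ 2 + K ^ 2 / 2 * (μ i * ‖x i - x₀‖ ^ 2)) atTop
          (𝓝 (a + K * 0 ^ 2 + K ^ 2 / 2 * 0)) :=
        (tendsto_const_nhds.add ((hs.pow 2).const_mul K)).add (hμs.const_mul _)
      refine (this.congr fun i => by ring).trans (by simp)
    refine tendsto_of_tendsto_of_tendsto_of_le_of_le' hlower hupper hlb ?_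
    filter_upwards [hxδ] with i hi
    exact (hle i).trans (hd (x i) hi (μ i) (hμ i)).2.2
  · refine tendsto_of_tendsto_of_tendsto_of_le_of_le' hlower hval hlb ?_
    filter_upwards [hxδ] with i hi
    refine (hle i).trans ((hd (x i) hi (μ i) (hμ i)).2.1.trans ?_)
    simp [linValue]

/-- Strict descent of proximal steps at points that are not critical. -/
theorem eventually_descent_of_isProxStepSeq {L ρ : ℝ} {Z : Set (EuclideanSpace ℝ (Fin m))}
    (hc : ContDiffAt ℝ 2 c x₀) (hZ : Z ∈ 𝓝 (c x₀)) (hZo : IsOpen Z) (hρ : 0 < ρ)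
    (hLx : ∀ᶠ x in 𝓝 x₀, ‖fderiv ℝ c x‖ ≤ L)
    (hmult : ∀ᶠ p : EuclideanSpace ℝ (Fin n) × EuclideanSpace ℝ (Fin m) in
      𝓝 x₀ ×ˢ attentive h (c x₀),
      ∀ d u, c p.1 + fderiv ℝ c p.1 d = p.2 →
        u ∈ regularSubdiff (fun e => h (c p.1 + fderiv ℝ c p.1 e)) d → ‖u‖ ≤ 1 →
        ∃ v, ContinuousLinearMap.adjoint (fderiv ℝ c p.1) v = u ∧ ∀ z ∈ Z,
          h p.2 + ((inner ℝ v (z - p.2) - ρ / 2 * ‖z - p.2‖ ^ 2 : ℝ) : EReal) ≤ h z)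
    {x d : ℕ → EuclideanSpace ℝ (Fin n)} {μ : ℕ → ℝ} (hμ0 : ∀ r, 0 ≤ μ r)
    (hμ : ∀ r, ρ * L ^ 2 < μ r)
    (hx : Tendsto x atTop (𝓝 x₀)) (hμx : Tendsto (fun r => μ r * ‖x r - x₀‖) atTop (𝓝 0))
    (hd : IsProxStepSeq h c x₀ x μ d) (hcr : ∀ r, ¬ IsCriticalPt (fun z => h (c z)) (x r)) :
    ∀ᶠ r in atTop, d r ≠ 0 ∧ proxLin h c (x r) (μ r) (d r) < proxLin h c (x r) (μ r) 0 := by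
  obtain ⟨hmin, hO, hval⟩ := hd
  have hs : Tendsto (fun r => x r - x₀) atTop (𝓝 0) := by
    simpa using hx.sub_const x₀
  have hd0 : Tendsto d atTop (𝓝 0) := hO.trans_tendsto hs
  have hpair : Tendsto (fun r => c (x r) + fderiv ℝ c (x r) (d r)) atTop (𝓝 (c x₀)) := by
    have h1 : ContinuousAt (fderiv ℝ c) x₀ :=
      (hc.fderiv_right (m := 1) (by norm_num)).continuousAt
    have h2 : Tendsto (fun r => fderiv ℝ c (x r) (d r)) atTop (𝓝 0) := by
      refine squeeze_zero_norm' (a := fun r => L * ‖d r‖) ?_ (by simpa using hd0.norm.const_mul L)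
      filter_upwards [hx.eventually hLx] with r hr
      exact (ContinuousLinearMap.le_opNorm _ _).trans
        (mul_le_mul_of_nonneg_right hr (norm_nonneg _))
    simpa using (hc.continuousAt.tendsto.comp hx).add h2
  have hμd : ∀ᶠ r in atTop, ‖-(μ r • d r)‖ ≤ 1 := by
    obtain ⟨C, hC⟩ := hO.bound
    have h1 : Tendsto (fun r => C * (μ r * ‖x r - x₀‖)) atTop (𝓝 0) := by
      simpa using hμx.const_mul C
    filter_upwards [hC, h1.eventually (gt_mem_nhds one_pos)] with r hr1 hr2
    rw [norm_neg, norm_smul, Real.norm_of_nonneg (hμ0 r)]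
    nlinarith [mul_le_mul_of_nonneg_left hr1 (hμ0 r)]
  have hatt : Tendsto (fun r => (x r, c (x r) + fderiv ℝ c (x r) (d r))) atTop
      (𝓝 x₀ ×ˢ attentive h (c x₀)) :=
    hx.prodMk (tendsto_attentive_iff.2 ⟨hpair, hval⟩)
  have hdiff : ∀ᶠ x in 𝓝 x₀, DifferentiableAt ℝ c x :=
    (hc.eventually (by simp)).mono fun x hx => hx.differentiableAt (by norm_num)
  filter_upwards [hmin, hμd, hatt.eventually hmult, hx.eventually hLx, hx.eventually hdiff,
    (hc.continuousAt.tendsto.comp hx).eventually hZ] with r h1 h2 h3 h4 h5 h6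
  obtain ⟨t, ht⟩ := (proxLin_finite_iff.1 h1.1).exists_coe
  obtain ⟨v, hv, hvZ⟩ := h3 (d r) _ rfl h1.mem_regularSubdiff_linValue h2
  change h (c (x r) + fderiv ℝ c (x r) (d r)) = t at ht
  -- If `d r = 0`, the multiplier has zero image and is a regular subgradient of `h` at `c (x r)`,
  -- which makes `x r` critical.
  have hne : d r ≠ 0 := by
    intro hd
    refine hcr r (regularSubdiff_subset_subdiff _ _ ?_)
    rw [hd, map_zero, add_zero] at ht hvZ
    rw [hd, smul_zero, neg_zero] at hv
    rw [← hv]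
    refine adjoint_mem_regularSubdiff_comp h5 (mem_regularSubdiff_of_quadratic ht (ρ / 2) ?_)
    filter_upwards [hZo.mem_nhds h6] with z hz
    have := hvZ z hz
    rwa [ht, ← EReal.coe_add, ← add_sub_assoc] at this
  refine ⟨hne, ?_⟩
  -- At `z = c (x r)` the linear term equals `μ‖d‖²`. The quadratic loss is below `(μ/2)‖d‖²`
  -- because `ρ * L ^ 2 < μ`.
  have hz := hvZ (c (x r)) h6
  have h7 : c (x r) - (c (x r) + fderiv ℝ c (x r) (d r)) = -(fderiv ℝ c (x r) (d r)) := by abel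
  rw [h7, ht, ← EReal.coe_add, inner_neg_right, norm_neg, ← ContinuousLinearMap.adjoint_inner_left,
    hv, inner_neg_left, inner_smul_left, real_inner_self_eq_norm_sq] at hz
  simp only [conj_trivial, neg_neg] at hz
  have h8 : ‖fderiv ℝ c (x r) (d r)‖ ^ 2 ≤ L ^ 2 * ‖d r‖ ^ 2 := by
    rw [← mul_pow]
    exact pow_le_pow_left₀ (norm_nonneg _) ((ContinuousLinearMap.le_opNorm _ _).trans
      (mul_le_mul_of_nonneg_right h4 (norm_nonneg _))) 2
  have h9 : 0 < ‖d r‖ ^ 2 := by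
    have := norm_pos_iff.2 hne
    positivity
  have h10 : proxLin h c (x r) (μ r) 0 = h (c (x r)) := by simp [proxLin, linValue]
  rw [h10]
  refine lt_of_lt_of_le ?_ hz
  rw [proxLin, linValue, ht, ← EReal.coe_add, EReal.coe_lt_coe_iff]
  nlinarith [mul_lt_mul_of_pos_right (hμ r) h9]

end ProximalStep

/-! ### Assembly. -/

theorem mainTheorem8 (n m : ℕ)
    (h : EuclideanSpace ℝ (Fin m) → EReal)
    (c : EuclideanSpace ℝ (Fin n) → EuclideanSpace ℝ (Fin m))
    (xbar : EuclideanSpace ℝ (Fin n))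
    (hc : ContDiffAt ℝ 2 c xbar)
    (hprox : ProxRegularAt h (c xbar))
    (hcrit : IsCriticalPt (fun x => h (c x)) xbar)
    (htrans : Transversal h c xbar) :
    ∃ μbar : ℝ, 0 ≤ μbar ∧ IsProxStepThreshold h c xbar μbar ∧
      ∀ (x : ℕ → EuclideanSpace ℝ (Fin n)) (μ : ℕ → ℝ),
        (∀ r, μbar < μ r) → Tendsto x atTop (𝓝 xbar) →
        Tendsto (fun r => μ r * ‖x r - xbar‖) atTop (𝓝 0) →
        (∃ d : ℕ → EuclideanSpace ℝ (Fin n), IsProxStepSeq h c xbar x μ d) ∧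
        (∀ d : ℕ → EuclideanSpace ℝ (Fin n), IsProxStepSeq h c xbar x μ d →
          (∀ r, ¬ IsCriticalPt (fun z => h (c z)) (x r)) →
          ∀ᶠ r in atTop, d r ≠ 0 ∧
            proxLin h c (x r) (μ r) (d r) < proxLin h c (x r) (μ r) 0) := by
  obtain ⟨a, ha⟩ := hprox.1.exists_coe
  have hdiff : ∀ᶠ x in 𝓝 xbar, DifferentiableAt ℝ c x :=
    (hc.eventually (by simp)).mono fun x hx => hx.differentiableAt (by norm_num)
  have hfc : ContinuousAt (fderiv ℝ c) xbar :=
    (hc.fderiv_right (m := 1) (by norm_num)).continuousAt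
  have hB := exists_norm_le_of_transversal hprox.1 hfc fun v hv hv0 => by
    have : v ∈ ({0} : Set (EuclideanSpace ℝ (Fin m))) := htrans ▸ ⟨hv, hv0⟩
    exact this
  obtain ⟨B, hB1⟩ := hB 1
  obtain ⟨v, hv, -, hv0⟩ := exists_mem_subdiff_adjoint_eq hprox.1 hfc (u := 0)
    (fun η hη => frequently_chain_of_mem_subdiff hdiff hprox.2.1 hcrit hη) (by simpa using hB1)
  have hlow : ∃ ρ : ℝ, 0 < ρ ∧ ∀ᶠ z in 𝓝 (c xbar),
      ((a + inner ℝ v (z - c xbar) - ρ / 2 * ‖z - c xbar‖ ^ 2 : ℝ) : EReal) ≤ h z := by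
    obtain ⟨ρ, hρ, ε, hε, H⟩ := hprox.2.2 v hv
    refine ⟨ρ, hρ, ?_⟩
    filter_upwards [Metric.ball_mem_nhds (c xbar) hε] with z hz
    have := H (c xbar) z (by simpa using hε) (by simpa [dist_eq_norm] using hz)
      (by rw [ha, ← EReal.coe_sub, EReal.coe_lt_coe_iff]; linarith)
      (by rw [ha, ← EReal.coe_add, EReal.coe_lt_coe_iff]; linarith) v hv (by simpa using hε)
    rwa [ha, ← EReal.coe_add, ← add_sub_assoc] at this
  obtain ⟨ρ, hρ, hlow⟩ := hlow
  obtain ⟨K₁, hK₁, hlin⟩ := exists_linearized_lower_bound hc hv0 hρ.le hlow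
  obtain ⟨K₂, hK₂, htrial⟩ := exists_trial_step ha hprox.2.1 hc hB hρ hlow
  obtain ⟨σ, hσ, Z, hZ, hZo, hmult⟩ := exists_uniform_multipliers hprox hB
  obtain ⟨L, hL, hLx⟩ := hc.exists_linearization_bounds
  set K : ℝ := max K₁ K₂
  have hK : 0 ≤ K := hK₁.trans (le_max_left _ _)
  -- The first entry makes the proximal term dominate the lower bound; the second gives strict
  -- descent.
  set μbar : ℝ := max (8 * K + 1) (σ * L ^ 2)
  have hμbar : 0 ≤ μbar := le_max_of_le_left (by positivity)
  have hthr : IsProxStepThreshold h c xbar μbar := by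
    refine isProxStepThreshold_of_bounds ha hprox.2.1 hc hK ?_ ?_ (le_max_left _ _)
    · filter_upwards [hlin] with p hp
      refine le_trans (EReal.coe_le_coe_iff.2 ?_) hp
      gcongr
      exact le_max_left _ _
    · filter_upwards [htrial] with x hx
      obtain ⟨d, hd1, hd2⟩ := hx
      refine ⟨d, hd1.trans ?_, hd2.trans (EReal.coe_le_coe_iff.2 ?_)⟩ <;>
      · gcongr
        exact le_max_right _ _
  refine ⟨μbar, hμbar, hthr, fun x μ hμ hx hμx => ⟨?_, fun d hd hcr => ?_⟩⟩
  · obtain ⟨δ, hδ, R, hR, d, hd, hlim⟩ := hthr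
    have hxδ : ∀ᶠ r in atTop, x r ∈ Metric.closedBall xbar δ :=
      hx.eventually (Metric.closedBall_mem_nhds xbar hδ)
    refine ⟨fun r => d (x r) (μ r), ?_, ?_, hlim x μ hx hμ (Or.inl ?_)⟩
    · exact hxδ.mono fun r hr => (hd _ hr _ (hμ r)).1
    · exact IsBigO.of_bound R (hxδ.mono fun r hr => (hd _ hr _ (hμ r)).2)
    · have := hμx.mul (tendsto_iff_norm_sub_tendsto_zero.1 hx)
      simpa [mul_assoc, ← sq] using this
  · exact eventually_descent_of_isProxStepSeq hc hZ hZo hσ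
      (hLx.mono fun x hx => hx.2.1) hmult (fun r => hμbar.trans (hμ r).le)
      (fun r => (le_max_right _ _).trans_lt (hμ r)) hx hμx hd hcr
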